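/- **Conventions.** Graphs are simple and may be infinite, of any cardinality. A *ray* is a one-way infinite path. Two rays $R,R'$ of $G$ are equivalent if there is no finite set $S$ of vertices such that $V(R)\setminus S$ and $V(R')\setminus S$ lie in different components of $G-S$; the equivalence classes are the *ends* of $G$, and $\Omega(G)$ is the set of ends. For an induced subgraph $H$ of $G$, $\partial_v H$ is the set of vertices of $H$ that have a neighbour outside $H$, $\partial_e H$ is the set of edges between $H$ and $G-H$, and $\Omega^G(H)$ is the set of ends of $G$ that have a ray in $H$. An *$\omega$-region* of an end $\omega$ is an induced connected subgraph that contains a ray of $\omega$ and has finite vertex-boundary $\partial_v H$. For $A\subseteq V(G)$ and $\Omega'\subseteq\Omega(G)$, an *$A$–$\Omega'$ separator* is a set $S\subseteq V(G)$ with $A\not\subseteq S$ such that no component of $G-S$ contains both a vertex of $A$ and a ray of an end in $\Omega'$. Write $(H_i)_{i\in\mathbb N}\to\omega$ if the $H_i$ are distinct $\omega$-regions such that, for every $i$, $H_{i+1}\subseteq H_i-\partial_v H_i$ and $\partial_v H_{i+1}$ is a $\subseteq$-minimal $\partial_v H_i$–$\Omega^G(H_{i+1})$ separator in $G$. A vertex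 $v$ *dominates* $\omega$ if for some ray $R$ of $\omega$ there are infinitely many $v$–$V(R)$ paths that are disjoint except in $v$. Let $Dom(\omega)$ be the set of vertices that dominate $\omega$, and let $G_\omega:=G-Dom(\omega)$. The *relative degree* of $\omega$ is $d_{e/v}(\omega):=|Dom(\omega)|$ if $Dom(\omega)$ is infinite or $G_\omega$ contains no ray of $\omega$; otherwise, with $\hat\omega$ the unique end of $G_\omega$ that contains rays of $\omega$, $$d_{e/v}(\omega):=|Dom(\omega)|+\inf_{(\hat H_i)\to\hat\omega}\ \liminf_{i\to\infty}\frac{|\partial_e\hat H_i|}{|\partial_v\hat H_i|},$$ where the $\hat H_i$ and their boundaries are taken in $G_\omega$, and all infinite values are identified with $\infty$. **Theorem.** Let $k\in\mathbb N$ and $m\in\mathbb Q$, and let $G$ be a non-empty graph with at most countably many ends. Suppose that $\delta^{V,\Omega}(G)>m$, that is, every vertex of $G$ has degree greater than $m$ and every end of $G$ has relative degree greater than $m$. Then $K^k$ is a topological minor of $G$ (that is, $G$ contains a subdivision of $K^k$), or $G$ has a finite non-empty subgraph of average degree greater than $m-k+1$. -/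

import Mathlib

open scoped ENNReal
open Filter

namespace SimpleGraph

/-! ### Rays and ends -/

/-- A ray (one-way infinite path) of `G`, listed from its first vertex on. -/
structure Ray {V : Type*} (G : SimpleGraph V) where
  vert : ℕ → V
  inj : Function.Injective vert
  adj : ∀ i, G.Adj (vert i) (vert (i + 1))

section Rays

variable {V : Type*} {G : SimpleGraph V}

/-- The vertex set of a ray. -/
def Ray.verts (R : G.Ray) : Set V := Set.range R.vert

/-- `S` separates two rays if what `S` leaves of them lies in different components of `G - S`. -/
def SeparatesRays (G : SimpleGraph V) (S : Set V) (R R' : G.Ray) : Prop :=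
  ∃ C C' : G.ComponentCompl S, C ≠ C' ∧ R.verts \ S ⊆ C.supp ∧ R'.verts \ S ⊆ C'.supp

/-- Two rays are equivalent if no finite set of vertices separates them. -/
def RayEquiv (G : SimpleGraph V) (R R' : G.Ray) : Prop :=
  ∀ S : Set V, S.Finite → ¬ G.SeparatesRays S R R'

theorem Ray.exists_component (R : G.Ray) {S : Set V} {n : ℕ}
    (hn : ∀ i, n ≤ i → R.vert i ∉ S) :
    ∃ C : G.ComponentCompl S, ∀ i, n ≤ i → R.vert i ∈ C.supp := by
  refine ⟨G.componentComplMk (hn n le_rfl), fun i hi => ?_⟩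
  induction i, hi using Nat.le_induction with
  | base => exact ⟨hn _ le_rfl, rfl⟩
  | succ i hi ih =>
    obtain ⟨h1, h2⟩ := ih
    refine ⟨hn _ (by omega), ?_⟩
    rw [← h2]
    exact (componentComplMk_eq_of_adj G h1 (hn _ (by omega)) (R.adj i)).symm

theorem Ray.exists_avoid (R : G.Ray) {S : Set V} (hS : S.Finite) (m : ℕ) :
    ∃ n, m ≤ n ∧ ∀ i, n ≤ i → R.vert i ∉ S := by
  obtain ⟨n, hn⟩ := (hS.preimage R.inj.injOn).bddAbove
  refine ⟨max m (n + 1), le_max_left _ _, fun i hi h => ?_⟩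
  have h1 : i ≤ n := hn h
  have h2 : n + 1 ≤ i := le_trans (le_max_right _ _) hi
  omega

/-- Two rays are equivalent iff for every finite `S` some component of `G - S` contains tails
of both. -/
theorem rayEquiv_iff {R R' : G.Ray} :
    G.RayEquiv R R' ↔ ∀ S : Set V, S.Finite → ∃ (n : ℕ) (C : G.ComponentCompl S),
      ∀ i, n ≤ i → R.vert i ∈ C.supp ∧ R'.vert i ∈ C.supp := by
  constructor
  · intro h S hS
    obtain ⟨n, -, hn⟩ := R.exists_avoid hS 0
    obtain ⟨C, hC⟩ := R.exists_component hn
    obtain ⟨n', -, hn'⟩ := R'.exists_avoid hS 0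
    obtain ⟨C', hC'⟩ := R'.exists_component hn'
    by_cases hCC : C = C'
    · subst hCC
      exact ⟨max n n', C, fun i hi =>
        ⟨hC i (le_trans (le_max_left _ _) hi), hC' i (le_trans (le_max_right _ _) hi)⟩⟩
    exfalso
    have hdisj : ∀ i j, n ≤ i → n' ≤ j → R.vert i ≠ R'.vert j := by
      intro i j hi hj e
      obtain ⟨h1, h2⟩ := hC i hi
      obtain ⟨h3, h4⟩ := hC' j hj
      apply hCC
      rw [← h2, ← h4]
      simp only [e]
    -- enlarge `S` by initial segments of the two rays
    have hT : (S ∪ (R.vert '' Set.Iio n ∪ R'.vert '' Set.Iio n')).Finite :=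
      hS.union (((Set.finite_Iio n).image _).union ((Set.finite_Iio n').image _))
    obtain ⟨a, hna, ha⟩ := R.exists_avoid hT n
    obtain ⟨a', hna', ha'⟩ := R'.exists_avoid hT n'
    set U : Set V := S ∪ (R.vert '' Set.Iio a ∪ R'.vert '' Set.Iio a') with hU
    have hUfin : U.Finite :=
      hS.union (((Set.finite_Iio a).image _).union ((Set.finite_Iio a').image _))
    have hSU : S ⊆ U := Set.subset_union_left
    have hR : ∀ i, a ≤ i → R.vert i ∉ U := by
      rintro i hi (hs | ⟨j, hj, e⟩ | ⟨j, hj, e⟩)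
      · exact ha i hi (Or.inl hs)
      · have := R.inj e
        simp only [Set.mem_Iio] at hj
        omega
      · by_cases hjn : j < n'
        · exact ha i hi (Or.inr (Or.inr ⟨j, hjn, e⟩))
        · exact hdisj i j (by omega) (by omega) e.symm
    have hR' : ∀ i, a' ≤ i → R'.vert i ∉ U := by
      rintro i hi (hs | ⟨j, hj, e⟩ | ⟨j, hj, e⟩)
      · exact ha' i hi (Or.inl hs)
      · by_cases hjn : j < n
        · exact ha' i hi (Or.inr (Or.inl ⟨j, hjn, e⟩))
        · exact hdisj j i (by omega) (by omega) e
      · have := R'.inj e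
        simp only [Set.mem_Iio] at hj
        omega
    obtain ⟨D, hD⟩ := R.exists_component hR
    obtain ⟨D', hD'⟩ := R'.exists_component hR'
    refine h U hUfin ⟨D, D', ?_, ?_, ?_⟩
    · rintro rfl
      apply hCC
      have h1 := D.subset_hom hSU (hD a le_rfl)
      have h2 := D.subset_hom hSU (hD' a' le_rfl)
      obtain ⟨_, e1⟩ := hC a hna
      obtain ⟨_, e2⟩ := hC' a' hna'
      obtain ⟨_, e3⟩ := h1
      obtain ⟨_, e4⟩ := h2
      rw [← e1, ← e2, e3, e4]
    · rintro _ ⟨⟨i, rfl⟩, hi⟩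
      refine hD i (not_lt.mp fun hlt => hi (Or.inr (Or.inl ⟨i, hlt, rfl⟩)))
    · rintro _ ⟨⟨i, rfl⟩, hi⟩
      refine hD' i (not_lt.mp fun hlt => hi (Or.inr (Or.inr ⟨i, hlt, rfl⟩)))
  · rintro h S hS ⟨C, C', hne, hC, hC'⟩
    obtain ⟨n, D, hD⟩ := h S hS
    obtain ⟨⟨h1, e1⟩, ⟨h2, e2⟩⟩ := hD n le_rfl
    obtain ⟨_, f1⟩ := hC ⟨⟨n, rfl⟩, h1⟩
    obtain ⟨_, f2⟩ := hC' ⟨⟨n, rfl⟩, h2⟩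
    exact hne (by rw [← f1, ← f2, e1, e2])

theorem rayEquiv_equivalence (G : SimpleGraph V) : Equivalence G.RayEquiv where
  refl R := rayEquiv_iff.2 fun S hS => by
    obtain ⟨n, -, hn⟩ := R.exists_avoid hS 0
    obtain ⟨C, hC⟩ := R.exists_component hn
    exact ⟨n, C, fun i hi => ⟨hC i hi, hC i hi⟩⟩
  symm h := rayEquiv_iff.2 fun S hS => by
    obtain ⟨n, C, hC⟩ := rayEquiv_iff.1 h S hS
    exact ⟨n, C, fun i hi => (hC i hi).symm⟩
  trans h h' := rayEquiv_iff.2 fun S hS => by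
    obtain ⟨n, C, hC⟩ := rayEquiv_iff.1 h S hS
    obtain ⟨n', C', hC'⟩ := rayEquiv_iff.1 h' S hS
    obtain ⟨_, e1⟩ := (hC (max n n') (le_max_left _ _)).2
    obtain ⟨_, e2⟩ := (hC' (max n n') (le_max_right _ _)).1
    have e : C = C' := by rw [← e1, ← e2]
    subst e
    exact ⟨max n n', C, fun i hi => ⟨(hC i (le_trans (le_max_left _ _) hi)).1,
      (hC' i (le_trans (le_max_right _ _) hi)).2⟩⟩

/-- Equivalence of rays, as a setoid. -/
def raySetoid (G : SimpleGraph V) : Setoid G.Ray := ⟨G.RayEquiv, G.rayEquiv_equivalence⟩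

/-- The set `Ω(G)` of ends of `G`: the equivalence classes of its rays. -/
def Ends (G : SimpleGraph V) : Type _ := Quotient G.raySetoid

/-- The end that contains a given ray. -/
def Ray.toEnd (R : G.Ray) : G.Ends := Quotient.mk G.raySetoid R

theorem Ray.toEnd_eq_iff {R R' : G.Ray} : R.toEnd = R'.toEnd ↔ G.RayEquiv R R' :=
  ⟨fun h => Quotient.exact h, fun h => Quotient.sound (s := G.raySetoid) h⟩

/-- A ray of an induced subgraph, as a ray of the whole graph. -/
def Ray.ofInduce {s : Set V} (R : (G.induce s).Ray) : G.Ray where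
  vert i := (R.vert i : V)
  inj := Subtype.val_injective.comp R.inj
  adj i := R.adj i

end Rays

/-! ### Regions, boundaries, separators, and the limit of the boundary ratios -/

section Regions

variable {V : Type*} (G : SimpleGraph V)

/-- The vertex-boundary of the subgraph induced by `H`: the vertices of `H` with a neighbour
outside `H`. -/
def vertexBoundary (H : Set V) : Set V := {v | v ∈ H ∧ ∃ w, w ∉ H ∧ G.Adj v w}

/-- The edge-boundary of the subgraph induced by `H`: the edges between `H` and the rest. -/
def edgeBoundary (H : Set V) : Set (Sym2 V) :=
  {e | ∃ v w, v ∈ H ∧ w ∉ H ∧ G.Adj v w ∧ e = s(v, w)}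

/-- The ends of `G` that have a ray in `H`. -/
def endsIn (H : Set V) : Set G.Ends := {ω | ∃ R : G.Ray, R.toEnd = ω ∧ R.verts ⊆ H}

/-- `H` is (the vertex set of) an `ω`-region: an induced connected subgraph which contains some ray
of `ω` and has a finite vertex-boundary. -/
def IsRegion (ω : G.Ends) (H : Set V) : Prop :=
  (G.induce H).Connected ∧ ω ∈ G.endsIn H ∧ (G.vertexBoundary H).Finite

/-- `S` is an `A`-`E` separator, for a set `A` of vertices and a set `E` of ends. -/
def IsEndSeparator (A : Set V) (E : Set G.Ends) (S : Set V) : Prop :=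
  ¬ A ⊆ S ∧ ∀ C : G.ComponentCompl S,
    ¬ ((∃ a ∈ A, a ∈ C.supp) ∧ ∃ R : G.Ray, R.toEnd ∈ E ∧ R.verts ⊆ C.supp)

/-- `(H i) → ω`: a sequence of distinct `ω`-regions such that `H (i + 1)` lies in `H i` minus the
vertex-boundary of `H i`, and the vertex-boundary of `H (i + 1)` is a `⊆`-minimal separator of the
vertex-boundary of `H i` from the ends that have a ray in `H (i + 1)`. -/
structure RegionsTendTo (H : ℕ → Set V) (ω : G.Ends) : Prop where
  distinct : Function.Injective H
  region : ∀ i, G.IsRegion ω (H i)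
  nested : ∀ i, H (i + 1) ⊆ H i \ G.vertexBoundary (H i)
  separator : ∀ i, Minimal (G.IsEndSeparator (G.vertexBoundary (H i)) (G.endsIn (H (i + 1))))
    (G.vertexBoundary (H (i + 1)))

/-- The ratio of the sizes of the edge-boundary and the vertex-boundary, all infinite sizes being
identified with `∞`. (In a sequence as above the vertex-boundaries are finite and non-empty.) -/
noncomputable def boundaryRatio (H : Set V) : ℝ≥0∞ :=
  ((G.edgeBoundary H).encard : ℝ≥0∞) / ((G.vertexBoundary H).encard : ℝ≥0∞)

/-- The infimum over all `(H i) → ω` of the lower limit of the boundary ratios. -/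
noncomputable def limitRatio (ω : G.Ends) : ℝ≥0∞ :=
  ⨅ (H : ℕ → Set V) (_ : G.RegionsTendTo H ω), liminf (fun i => G.boundaryRatio (H i)) atTop

end Regions

/-! ### Dominating vertices and the relative degree of an end -/

section Degrees

variable {V : Type*} (G : SimpleGraph V)

/-- `v` dominates the end `ω`: for some ray `R` of `ω` there are infinitely many paths from `v`
to `R`, each with only its last vertex on `R`, any two of which have only `v` in common. -/
def Dominates (v : V) (ω : G.Ends) : Prop :=
  ∃ R : G.Ray, R.toEnd = ω ∧ ∃ P : Set (Σ w : V, G.Path v w), P.Infinite ∧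
    (∀ p ∈ P, ∀ x ∈ p.2.1.support, x ∈ R.verts ↔ x = p.1) ∧
    P.Pairwise fun p q => ∀ x, x ∈ p.2.1.support → x ∈ q.2.1.support → x = v

/-- The set `Dom(ω)` of the vertices that dominate `ω`. -/
def Dom (ω : G.Ends) : Set V := {v | G.Dominates v ω}

/-- The graph `G_ω = G - Dom(ω)`. -/
abbrev undominated (ω : G.Ends) : SimpleGraph ↥(G.Dom ω)ᶜ := G.induce (G.Dom ω)ᶜ

/-- The end `η` of `G_ω` contains a ray of `ω`. -/
def IsHatEnd (ω : G.Ends) (η : (G.undominated ω).Ends) : Prop :=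
  ∃ R : (G.undominated ω).Ray, R.toEnd = η ∧ R.ofInduce.toEnd = ω

/-- If `Dom(ω)` is finite then at most one end of `G_ω` contains rays of `ω`. -/
theorem IsHatEnd.unique {ω : G.Ends} (hfin : (G.Dom ω).Finite) {η η' : (G.undominated ω).Ends}
    (h : G.IsHatEnd ω η) (h' : G.IsHatEnd ω η') : η = η' := by
  obtain ⟨R, rfl, hR⟩ := h
  obtain ⟨R', rfl, hR'⟩ := h'
  have hRR' := rayEquiv_iff.1 (Ray.toEnd_eq_iff.1 (hR.trans hR'.symm))
  rw [Ray.toEnd_eq_iff, rayEquiv_iff]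
  intro S hS
  obtain ⟨n, C, hC⟩ := hRR' (G.Dom ω ∪ Subtype.val '' S) (hfin.union (hS.image _))
  -- `G - (Dom(ω) ∪ S)` is the same graph as `G_ω - S`
  let f : G.induce (G.Dom ω ∪ Subtype.val '' S)ᶜ →g (G.undominated ω).induce Sᶜ :=
    { toFun := fun x => ⟨⟨x.1, fun hx => x.2 (Or.inl hx)⟩, fun hx => x.2 (Or.inr ⟨_, hx, rfl⟩)⟩
      map_rel' := fun h => h }
  refine ⟨n, C.map f, fun i hi => ?_⟩
  obtain ⟨⟨h1, rfl⟩, ⟨h2, e⟩⟩ := hC i hi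
  refine ⟨⟨fun hx => h1 (Or.inr ⟨_, hx, rfl⟩), rfl⟩, ⟨fun hx => h2 (Or.inr ⟨_, hx, rfl⟩), ?_⟩⟩
  rw [← e]
  rfl

open Classical in
/-- The relative degree `d_{e/v}(ω)` of an end, all infinite values being identified with `∞`.
It is `|Dom(ω)|` if `Dom(ω)` is infinite or `G_ω` contains no ray of `ω`, and otherwise the sum of
`|Dom(ω)|` and the limit ratio, in `G_ω`, of the unique end of `G_ω` that contains rays of `ω`. -/
noncomputable def relativeDegree (ω : G.Ends) : ℝ≥0∞ :=
  if h : (G.Dom ω).Finite ∧ ∃ η, G.IsHatEnd ω η then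
    ((G.Dom ω).encard : ℝ≥0∞) + (G.undominated ω).limitRatio h.2.choose
  else ((G.Dom ω).encard : ℝ≥0∞)

/-- The degree of a vertex, infinite degrees being identified with `∞`. -/
noncomputable def vertexDegree (v : V) : ℝ≥0∞ := ((G.neighborSet v).encard : ℝ≥0∞)

/-- `δ^{V,Ω}(G) > m`: all vertices have degree, and all ends have relative degree, greater
than `m`. -/
def MinDegreeGT (m : ℚ) : Prop :=
  (∀ v : V, ((m : ℝ) : EReal) < (G.vertexDegree v : EReal)) ∧
    ∀ ω : G.Ends, ((m : ℝ) : EReal) < (G.relativeDegree ω : EReal)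

end Degrees

/-! ### Topological minors and average degree -/

/-- `X` is a topological minor of `G`: `G` contains a subdivision of `X`, with branch vertices
`f x`, in which the edge `xy` is replaced by the path `P x y`. An edge comes with a path for each of
its two orientations, either of which can serve: nothing is required of their intersection. -/
def IsTopologicalMinor {W V : Type*} (X : SimpleGraph W) (G : SimpleGraph V) : Prop :=
  ∃ (f : W ↪ V) (P : ∀ x y : W, X.Adj x y → G.Path (f x) (f y)),
    (∀ x y (h : X.Adj x y) (z : W), f z ∈ (P x y h).1.support → z = x ∨ z = y) ∧
    ∀ x y (h : X.Adj x y) x' y' (h' : X.Adj x' y'), s(x, y) ≠ s(x', y') →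
      ∀ v, v ∈ (P x y h).1.support → v ∈ (P x' y' h').1.support → v ∈ Set.range f

/-- The average degree of a finite (non-empty) subgraph: the sum of its degrees divided by the
number of its vertices. -/
noncomputable def Subgraph.averageDegree {V : Type*} {G : SimpleGraph V} (H : G.Subgraph) : ℚ :=
  (∑ᶠ v ∈ H.verts, ((H.neighborSet v).ncard : ℚ)) / (H.verts.ncard : ℚ)

end SimpleGraph

/-!
Let `c = m - k + 1`. If some end is dominated by `k` vertices, these are pairwise inseparable by
finite sets of other vertices, so that they are the branch vertices of a subdivision of `K^k`
(`isTopologicalMinor_of_dominates`). Otherwise fewer than `k` vertices dominate any given end `ω`,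
which leaves a limit ratio of more than `c` for the end `ω̂` of `G_ω = G - Dom(ω)`. As `ω̂` is
undominated in `G_ω`, there are sequences of regions converging to it that avoid any given finite
set (`exists_regionsTendTo`: take minimal finite separators one after the other), so that `ω` can be
cut off, arbitrarily far out, by a region of `G_ω` with boundary ratio more than `c`
(`exists_cutsOff`).

Since there are only countably many ends, they can be cut off one after the other
(`exists_forall_cutsOff`), each region avoiding the finitely many vertices on which the earlier
choices rely. The regions are laminar, and the maximal ones are disjoint. Delete from them all but
their vertex-boundaries, the "cores". Only vertices dominating the end that is cut off lose
neighbours in this way, and finitely many neighbours of these are kept from deletion; so a vertex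
outside the regions keeps more than `c` neighbours, while from the core of a region there are more
than `c` times as many edges to other remaining vertices as the core has vertices.

Now contract each maximal region. Starting at one vertex of the contraction, add the other
endpoints of the finitely many edges that count for it, and go on like this. If the process
stops, the vertices outside the regions and the cores reached induce a finite subgraph, and counting
edges core by core shows that its average degree exceeds `c`. If not, Kőnig's lemma gives a ray of the contraction,
which lifts to a ray of `G`, as the regions are connected (`exists_averageDegree_or_ray`). But every
ray of `G` has a tail in the region of its end, hence in a single maximal region, a contradiction
(`exists_averageDegree_of_cutsOff`).
-/

namespace SimpleGraph

/-! ### Connections that avoid a set of vertices -/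

section Avoiding

variable {V : Type*} {G : SimpleGraph V}

/-- `G.JoinedOff S u v`: some walk of `G` joins `u` to `v` and avoids `S` altogether, its ends
included. This is reachability in `G - S`, without the passage to a subtype. -/
def JoinedOff (G : SimpleGraph V) (S : Set V) (u v : V) : Prop :=
  ∃ p : G.Walk u v, ∀ x ∈ p.support, x ∉ S

variable {S T : Set V} {u v w : V}

theorem JoinedOff.refl (h : u ∉ S) : G.JoinedOff S u u :=
  ⟨Walk.nil, by simpa using h⟩

theorem JoinedOff.symm (h : G.JoinedOff S u v) : G.JoinedOff S v u := by
  obtain ⟨p, hp⟩ := h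
  exact ⟨p.reverse, by simpa using hp⟩

theorem JoinedOff.trans (h : G.JoinedOff S u v) (h' : G.JoinedOff S v w) :
    G.JoinedOff S u w := by
  obtain ⟨p, hp⟩ := h
  obtain ⟨q, hq⟩ := h'
  refine ⟨p.append q, fun x hx => ?_⟩
  rw [Walk.mem_support_append_iff] at hx
  exact hx.elim (hp x) (hq x)

theorem JoinedOff.left_notMem (h : G.JoinedOff S u v) : u ∉ S :=
  h.elim fun p hp => hp _ p.start_mem_support

theorem JoinedOff.right_notMem (h : G.JoinedOff S u v) : v ∉ S := h.symm.left_notMem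

theorem JoinedOff.mono (hTS : T ⊆ S) (h : G.JoinedOff S u v) : G.JoinedOff T u v :=
  h.imp fun _ hp x hx hxT => hp x hx (hTS hxT)

theorem JoinedOff.of_adj (h : G.Adj u v) (hu : u ∉ S) (hv : v ∉ S) : G.JoinedOff S u v :=
  ⟨h.toWalk, by simp [hu, hv]⟩

/-- A set that is closed under adjacency outside `S` is closed under connections off `S`. -/
theorem JoinedOff.mem_of_closed {X : Set V}
    (hX : ∀ a ∈ X, ∀ b, G.Adj a b → b ∉ S → b ∈ X) (h : G.JoinedOff S u v) (hu : u ∈ X) :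
    v ∈ X := by
  obtain ⟨p, hp⟩ := h
  induction p with
  | nil => exact hu
  | cons hadj q ih =>
    simp only [Walk.support_cons, List.mem_cons] at hp
    exact ih (hX _ hu _ hadj (hp _ (Or.inr q.start_mem_support)))
      (fun x hx => hp x (Or.inr hx))

/-- If `X` is closed under adjacency outside `S` and disjoint from `T`, then connections off `S`
that start in `X` are connections off `T`. -/
theorem JoinedOff.of_closed {X : Set V}
    (hX : ∀ a ∈ X, ∀ b, G.Adj a b → b ∉ S → b ∈ X) (hXT : Disjoint X T)
    (h : G.JoinedOff S u v) (hu : u ∈ X) : G.JoinedOff T u v := by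
  obtain ⟨p, hp⟩ := h
  refine ⟨p, fun x hx => ?_⟩
  have hux : G.JoinedOff S u x := by
    classical
    exact ⟨p.takeUntil x hx, fun y hy => hp y (p.support_takeUntil_subset_support hx hy)⟩
  exact Set.disjoint_left.1 hXT (hux.mem_of_closed hX hu)

theorem joinedOff_iff_reachable (hu : u ∉ S) (hv : v ∉ S) :
    G.JoinedOff S u v ↔ (G.induce Sᶜ).Reachable ⟨u, hu⟩ ⟨v, hv⟩ := by
  constructor
  · rintro ⟨p, hp⟩
    exact ⟨p.induce Sᶜ hp⟩
  · rintro ⟨p⟩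
    refine ⟨p.map (Embedding.induce Sᶜ).toHom, fun x hx => ?_⟩
    have hx' := (Walk.support_map (Embedding.induce Sᶜ).toHom p) ▸ hx
    obtain ⟨y, -, rfl⟩ := List.mem_map.1 hx'
    exact y.2

theorem ComponentCompl.joinedOff {C : G.ComponentCompl S} (hu : u ∈ C.supp) (hv : v ∈ C.supp) :
    G.JoinedOff S u v := by
  obtain ⟨hu, rfl⟩ := hu
  obtain ⟨hv, h⟩ := hv
  exact (joinedOff_iff_reachable hu hv).2 (ConnectedComponent.exact h.symm)

theorem JoinedOff.mem_componentCompl {C : G.ComponentCompl S} (h : G.JoinedOff S u v)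
    (hu : u ∈ C.supp) : v ∈ C.supp := by
  obtain ⟨hu, rfl⟩ := hu
  exact ⟨h.right_notMem, ConnectedComponent.sound
    ((joinedOff_iff_reachable h.right_notMem hu).1 h.symm)⟩

/-- A walk from `u` into `X` can be cut off at its first vertex in `X`. -/
theorem Walk.exists_first_hit {X : Set V} (p : G.Walk u w) (hw : w ∈ X) :
    ∃ (w' : V) (q : G.Walk u w'), w' ∈ X ∧ q.support ⊆ p.support ∧
      ∀ x ∈ q.support, x ∈ X ↔ x = w' := by
  induction p with
  | nil => exact ⟨_, Walk.nil, hw, by simp, by simpa using hw⟩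
  | @cons u v w hadj p ih =>
    by_cases hu : u ∈ X
    · exact ⟨u, Walk.nil, hu, by simp, by simpa using hu⟩
    · obtain ⟨w', q, hw', hsub, hq⟩ := ih hw
      refine ⟨w', Walk.cons hadj q, hw', ?_, ?_⟩
      · rw [Walk.support_cons, Walk.support_cons]
        exact List.cons_subset_cons _ hsub
      · intro x hx
        rw [Walk.support_cons, List.mem_cons] at hx
        rcases hx with rfl | hx
        · exact ⟨fun h => absurd h hu, fun h => absurd (h ▸ hw') hu⟩
        · exact hq x hx

end Avoiding

/-! ### Rays and the components that contain their tails -/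

section Tails

variable {V : Type*} {G : SimpleGraph V}

/-- The vertices that a connection off `S` joins to some tail of the ray `R`. For finite `S` this is
the component of `G - S` in which `R` has a tail. -/
def Ray.tailComponent (R : G.Ray) (S : Set V) : Set V :=
  {v | ∃ n, ∀ i, n ≤ i → G.JoinedOff S v (R.vert i)}

/-- The ray `R` without its first `n` vertices. -/
def Ray.drop (R : G.Ray) (n : ℕ) : G.Ray where
  vert i := R.vert (n + i)
  inj i j h := by simpa using R.inj h
  adj i := R.adj (n + i)

variable {R R' : G.Ray} {S T : Set V} {u v : V}

theorem Ray.joinedOff {n : ℕ} (hn : ∀ i, n ≤ i → R.vert i ∉ S) {i j : ℕ} (hi : n ≤ i)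
    (hj : n ≤ j) : G.JoinedOff S (R.vert i) (R.vert j) := by
  obtain ⟨C, hC⟩ := R.exists_component hn
  exact ComponentCompl.joinedOff (hC i hi) (hC j hj)

theorem Ray.exists_joinedOff (R : G.Ray) (hS : S.Finite) (m : ℕ) :
    ∃ n, m ≤ n ∧ ∀ i j, n ≤ i → n ≤ j → G.JoinedOff S (R.vert i) (R.vert j) := by
  obtain ⟨n, hmn, hn⟩ := R.exists_avoid hS m
  exact ⟨n, hmn, fun i j hi hj => R.joinedOff hn hi hj⟩

theorem RayEquiv.exists_joinedOff (h : G.RayEquiv R R') (hS : S.Finite) :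
    ∃ n, ∀ i j, n ≤ i → n ≤ j → G.JoinedOff S (R.vert i) (R'.vert j) := by
  obtain ⟨n, C, hC⟩ := rayEquiv_iff.1 h S hS
  exact ⟨n, fun i j hi hj => ComponentCompl.joinedOff (hC i hi).1 (hC j hj).2⟩

theorem RayEquiv.tailComponent_eq (h : G.RayEquiv R R') (hS : S.Finite) :
    R.tailComponent S = R'.tailComponent S := by
  obtain ⟨n, hn⟩ := h.exists_joinedOff hS
  ext v
  constructor
  · rintro ⟨m, hm⟩
    exact ⟨max m n, fun i hi => (hm i (le_trans (le_max_left _ _) hi)).trans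
      (hn i i (le_trans (le_max_right _ _) hi) (le_trans (le_max_right _ _) hi))⟩
  · rintro ⟨m, hm⟩
    exact ⟨max m n, fun i hi => (hm i (le_trans (le_max_left _ _) hi)).trans
      (hn i i (le_trans (le_max_right _ _) hi) (le_trans (le_max_right _ _) hi)).symm⟩

theorem Ray.drop_toEnd (R : G.Ray) (n : ℕ) : (R.drop n).toEnd = R.toEnd := by
  rw [Ray.toEnd_eq_iff, rayEquiv_iff]
  intro S hS
  obtain ⟨m, -, hm⟩ := R.exists_avoid hS 0
  obtain ⟨C, hC⟩ := R.exists_component hm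
  exact ⟨m, C, fun i hi => ⟨hC (n + i) (by omega), hC i hi⟩⟩

theorem Ray.exists_mem_tailComponent (R : G.Ray) (hS : S.Finite) :
    ∃ n, ∀ i, n ≤ i → R.vert i ∈ R.tailComponent S := by
  obtain ⟨n, -, hn⟩ := R.exists_joinedOff hS 0
  exact ⟨n, fun i hi => ⟨n, fun j hj => hn i j hi hj⟩⟩

theorem Ray.tailComponent_closed (R : G.Ray) (S : Set V) :
    ∀ a ∈ R.tailComponent S, ∀ b, G.Adj a b → b ∉ S → b ∈ R.tailComponent S := by
  rintro a ⟨n, hn⟩ b hab hb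
  exact ⟨n, fun i hi => (JoinedOff.of_adj hab.symm hb (hn i hi).left_notMem).trans (hn i hi)⟩

theorem Ray.disjoint_tailComponent (R : G.Ray) (S : Set V) : Disjoint (R.tailComponent S) S := by
  rw [Set.disjoint_left]
  rintro a ⟨n, hn⟩
  exact (hn n le_rfl).left_notMem

theorem Ray.tailComponent_anti (R : G.Ray) (hTS : T ⊆ S) :
    R.tailComponent S ⊆ R.tailComponent T := by
  rintro a ⟨n, hn⟩
  exact ⟨n, fun i hi => (hn i hi).mono hTS⟩

theorem Ray.joinedOff_of_mem_tailComponent (hu : u ∈ R.tailComponent S)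
    (hv : v ∈ R.tailComponent S) : G.JoinedOff S u v := by
  obtain ⟨n, hn⟩ := hu
  obtain ⟨m, hm⟩ := hv
  exact (hn (max n m) (le_max_left _ _)).trans (hm (max n m) (le_max_right _ _)).symm

theorem JoinedOff.mem_tailComponent (h : G.JoinedOff S u v) (hv : v ∈ R.tailComponent S) :
    u ∈ R.tailComponent S := by
  obtain ⟨n, hn⟩ := hv
  exact ⟨n, fun i hi => h.trans (hn i hi)⟩

theorem Ray.tailComponent_subset_of_closed {X : Set V}
    (hX : ∀ a ∈ X, ∀ b, G.Adj a b → b ∉ S → b ∈ X) (hR : ∀ n, ∃ i, n ≤ i ∧ R.vert i ∈ X) :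
    R.tailComponent S ⊆ X := by
  rintro a ⟨n, hn⟩
  obtain ⟨i, hi, hiX⟩ := hR n
  exact (hn i hi).symm.mem_of_closed hX hiX

/-- A tail component of `G - S` that is disjoint from `T` lies in the tail component of `G - T`. -/
theorem Ray.tailComponent_subset_of_disjoint (R : G.Ray) (h : Disjoint (R.tailComponent S) T) :
    R.tailComponent S ⊆ R.tailComponent T := by
  rintro a ha
  obtain ⟨n, hn⟩ := id ha
  exact ⟨n, fun i hi => (hn i hi).of_closed (R.tailComponent_closed S) h ha⟩

end Tails

/-! ### Choosing countably many finite objects one after the other -/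

/-- Suppose that for each index `i` one can choose an object with the property `Q i` whose carrier
avoids any given finite set. Then objects can be chosen for all indices so that the carrier of
each avoids the finite shadows of all the earlier ones. -/
theorem exists_avoiding_choice {ι V : Type*} {α : ι → Type*} (e : ι → ℕ)
    (he : Function.Injective e) (Q : ∀ i, α i → Prop) (carrier shadow : ∀ i, α i → Set V)
    (hfin : ∀ i a, Q i a → (shadow i a).Finite)
    (h : ∀ i (F : Set V), F.Finite → ∃ a, Q i a ∧ Disjoint (carrier i a) F) :
    ∃ g : ∀ i, α i, (∀ i, Q i (g i)) ∧
      ∀ i j, e j < e i → Disjoint (carrier i (g i)) (shadow j (g j)) := by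
  classical
  have h' : ∀ i (F : Set V), ∃ a, Q i a ∧ (F.Finite → Disjoint (carrier i a) F) := by
    intro i F
    by_cases hF : F.Finite
    · obtain ⟨a, ha, ha'⟩ := h i F hF
      exact ⟨a, ha, fun _ => ha'⟩
    · obtain ⟨a, ha, -⟩ := h i ∅ Set.finite_empty
      exact ⟨a, ha, fun hF' => absurd hF' hF⟩
  choose c hc hcF using h'
  let wf : WellFounded fun j i => e j < e i := (measure e).wf
  let step : ∀ i, (∀ j, e j < e i → α j) → α i := fun i rec =>
    c i {v | ∃ (j : ι) (hj : e j < e i), v ∈ shadow j (rec j hj)}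
  let g : ∀ i, α i := wf.fix step
  have hg : ∀ i, g i = c i {v | ∃ j, ∃ _ : e j < e i, v ∈ shadow j (g j)} := fun i =>
    wf.fix_eq step i
  have hQ : ∀ i, Q i (g i) := fun i => by rw [hg]; exact hc _ _
  refine ⟨g, hQ, fun i j hj => ?_⟩
  have hF : {v | ∃ j, ∃ _ : e j < e i, v ∈ shadow j (g j)}.Finite := by
    have hlt : {j | e j < e i}.Finite := (Set.finite_Iio (e i)).preimage he.injOn
    refine (hlt.biUnion fun j _ => hfin j (g j) (hQ j)).subset ?_
    rintro v ⟨j, hj, hv⟩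
    exact Set.mem_biUnion (show j ∈ {j | e j < e i} from hj) hv
  have hdisj := hcF i _ hF
  rw [← hg] at hdisj
  have hsub : shadow j (g j) ⊆ {v | ∃ j, ∃ _ : e j < e i, v ∈ shadow j (g j)} :=
    fun v hv => ⟨j, hj, hv⟩
  exact hdisj.mono_right hsub

/-! ### Dominating vertices and subdivisions of complete graphs -/

section Domination

variable {V : Type*} {G : SimpleGraph V}

/-- A dominating vertex is not separated from its end by any finite set that does not contain
it. -/
theorem Dominates.mem_tailComponent {R : G.Ray} {v : V} (h : G.Dominates v R.toEnd) {T : Set V}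
    (hT : T.Finite) (hv : v ∉ T) : v ∈ R.tailComponent T := by
  obtain ⟨R', hR', P, hP, hend, hdisj⟩ := h
  rw [← (Ray.toEnd_eq_iff.1 hR').tailComponent_eq hT]
  obtain ⟨n, hn⟩ := R'.exists_mem_tailComponent hT
  have hendmem : ∀ p ∈ P, p.1 ∈ R'.verts := fun p hp =>
    (hend p hp p.1 p.2.1.end_mem_support).2 rfl
  -- the paths in `P` end in different vertices: only a trivial path could end in `v`
  have hinj : ∀ p ∈ P, ∀ q ∈ P, p.1 = q.1 → p = q := by
    intro p hp q hq hpq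
    by_contra hne
    have hpv : p.1 = v := hdisj hp hq hne p.1 p.2.1.end_mem_support
      (by rw [hpq]; exact q.2.1.end_mem_support)
    apply hne
    obtain ⟨w, p⟩ := p
    obtain ⟨w', q⟩ := q
    obtain rfl : w = w' := hpq
    obtain rfl : w = v := hpv
    rw [p.loop_eq, q.loop_eq]
  -- finitely many of them are spoilt by the vertices of `T` and the first `n` vertices of `R'`
  have hbad : {p ∈ P | ∃ t ∈ T ∪ (R'.vert '' Set.Iio n) \ {v}, t ∈ p.2.1.support}.Finite := by
    have hfin : (T ∪ (R'.vert '' Set.Iio n) \ {v}).Finite :=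
      hT.union (((Set.finite_Iio n).image _).sdiff)
    refine (hfin.biUnion (t := fun t => {p ∈ P | t ∈ p.2.1.support}) fun t ht => ?_).subset ?_
    · refine Set.Subsingleton.finite ?_
      rintro p ⟨hp, htp⟩ q ⟨hq, htq⟩
      by_contra hne
      have htv := hdisj hp hq hne t htp htq
      rcases ht with ht | ht
      · exact hv (htv ▸ ht)
      · exact ht.2 htv
    · rintro p ⟨hp, t, ht, htp⟩
      exact Set.mem_biUnion ht ⟨hp, htp⟩
  have hloop : {p ∈ P | p.1 = v}.Finite := by
    refine Set.Subsingleton.finite ?_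
    rintro p ⟨hp, h1⟩ q ⟨hq, h2⟩
    exact hinj p hp q hq (h1.trans h2.symm)
  obtain ⟨p, hp, hpgood⟩ := (hP.sdiff (hbad.union hloop)).nonempty
  have hpv : p.1 ≠ v := fun h => hpgood (Or.inr ⟨hp, h⟩)
  have hpT : ∀ t ∈ T ∪ (R'.vert '' Set.Iio n) \ {v}, t ∉ p.2.1.support :=
    fun t ht htp => hpgood (Or.inl ⟨hp, t, ht, htp⟩)
  obtain ⟨i, hi⟩ := hendmem p hp
  have hni : n ≤ i := by
    by_contra hlt
    refine hpT p.1 (Or.inr ⟨⟨i, ?_, hi⟩, hpv⟩) p.2.1.end_mem_support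
    simpa using hlt
  have hjoin : G.JoinedOff T v p.1 := ⟨p.2.1, fun x hx hxT => hpT x (Or.inl hxT) hx⟩
  exact hjoin.mem_tailComponent (hi ▸ hn i hni)

/-- A vertex that no finite set separates from the end of a ray dominates this end. -/
theorem dominates_of_mem_tailComponent {R : G.Ray} {v : V}
    (h : ∀ T : Set V, T.Finite → v ∉ T → v ∈ R.tailComponent T) : G.Dominates v R.toEnd := by
  classical
  obtain ⟨m, -, hm⟩ := R.exists_avoid (Set.finite_singleton v) 0
  set R' := R.drop m with hR'
  have hvR' : v ∉ R'.verts := by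
    rintro ⟨i, hi⟩
    exact hm (m + i) (by omega) hi
  refine ⟨R', R.drop_toEnd m, ?_⟩
  obtain ⟨g, hg, hgd⟩ := exists_avoiding_choice (ι := ℕ) (V := V)
    (α := fun _ => Σ w : V, G.Path v w) id Function.injective_id
    (fun _ p => ∀ x ∈ p.2.1.support, x ∈ R'.verts ↔ x = p.1)
    (fun _ p => {x | x ∈ p.2.1.support ∧ x ≠ v}) (fun _ p => {x | x ∈ p.2.1.support ∧ x ≠ v})
    (fun _ p _ => (List.finite_toSet p.2.1.support).subset fun x hx => hx.1) (by
      intro _ F hF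
      obtain ⟨n, hn⟩ := h (F \ {v}) hF.sdiff (fun h => h.2 rfl)
      obtain ⟨p, hp⟩ := hn (m + n) (by omega)
      obtain ⟨w, q, -, hsub, hq⟩ := p.exists_first_hit (X := R'.verts) ⟨n, rfl⟩
      have hsub' := q.support_toPath_subset_support
      refine ⟨⟨w, q.toPath⟩, fun x hx => hq x (hsub' hx), ?_⟩
      rw [Set.disjoint_left]
      rintro x ⟨hx, hxv⟩ hxF
      exact hp x (hsub (hsub' hx)) ⟨hxF, hxv⟩)
  have hdisj : ∀ i j, i ≠ j → ∀ x, x ∈ (g i).2.1.support → x ∈ (g j).2.1.support → x = v := by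
    intro i j hij x hi hj
    by_contra hxv
    rcases lt_or_gt_of_ne hij with hlt | hlt
    · exact Set.disjoint_left.1 (hgd j i hlt) ⟨hj, hxv⟩ ⟨hi, hxv⟩
    · exact Set.disjoint_left.1 (hgd i j hlt) ⟨hi, hxv⟩ ⟨hj, hxv⟩
  have hgv : ∀ i, (g i).1 ≠ v := fun i hi =>
    hvR' (hi ▸ (hg i (g i).1 (g i).2.1.end_mem_support).2 rfl)
  have hginj : Function.Injective g := by
    intro i j hij
    by_contra hne
    exact hgv i (hdisj i j hne (g i).1 (g i).2.1.end_mem_support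
      (hij ▸ (g i).2.1.end_mem_support))
  refine ⟨Set.range g, Set.infinite_range_of_injective hginj, ?_, ?_⟩
  · rintro _ ⟨i, rfl⟩
    exact hg i
  · rintro _ ⟨i, rfl⟩ _ ⟨j, rfl⟩ hne
    exact hdisj i j fun h => hne (h ▸ rfl)

/-- Any `k` vertices that dominate one end are the branch
vertices of a subdivision of `K^k`, as no finite set of other vertices separates two of them. -/
theorem isTopologicalMinor_of_dominates {k : ℕ} {ω : G.Ends} (f : Fin k ↪ V)
    (hf : ∀ x, G.Dominates (f x) ω) : (⊤ : SimpleGraph (Fin k)).IsTopologicalMinor G := by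
  classical
  obtain ⟨R, rfl⟩ := Quotient.exists_rep ω
  obtain ⟨g, hg, hgd⟩ := exists_avoiding_choice (ι := Fin k × Fin k) (V := V)
    (α := fun i => G.Path (f i.1) (f i.2)) (fun i => (finProdFinEquiv i : ℕ))
    (fun i j h => finProdFinEquiv.injective (Fin.ext h))
    (fun i p => ∀ z, f z ∈ p.1.support → z = i.1 ∨ z = i.2)
    (fun i p => {x | x ∈ p.1.support ∧ x ∉ Set.range f})
    (fun i p => {x | x ∈ p.1.support})
    (fun i p _ => List.finite_toSet p.1.support) (by
      rintro ⟨x, y⟩ F hF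
      set T : Set V := (F ∪ Set.range f) \ {f x, f y} with hT
      have hTfin : T.Finite := (hF.union (Set.finite_range f)).sdiff
      have hx := (hf x).mem_tailComponent (R := R) hTfin (by simp [hT])
      have hy := (hf y).mem_tailComponent (R := R) hTfin (by simp [hT])
      obtain ⟨p, hp⟩ := Ray.joinedOff_of_mem_tailComponent hx hy
      have hsub := p.support_toPath_subset_support
      refine ⟨p.toPath, fun z hz => ?_, ?_⟩
      · by_contra hzxy
        refine hp _ (hsub hz) ⟨Or.inr ⟨z, rfl⟩, ?_⟩
        simpa [f.injective.eq_iff] using hzxy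
      · rw [Set.disjoint_left]
        rintro v ⟨hv, hvf⟩ hvF
        refine hp _ (hsub hv) ⟨Or.inl hvF, ?_⟩
        rintro (h | h)
        · exact hvf ⟨x, h.symm⟩
        · exact hvf ⟨y, h.symm⟩)
  refine ⟨f, fun x y _ => g (x, y), fun x y _ z hz => hg (x, y) z hz, ?_⟩
  intro x y _ x' y' _ hne v hv hv'
  by_contra hvf
  have hne' : finProdFinEquiv (x, y) ≠ finProdFinEquiv (x', y') := by
    intro h
    have := finProdFinEquiv.injective h
    simp only [Prod.mk.injEq] at this
    exact hne (by rw [this.1, this.2])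
  rcases lt_or_gt_of_ne hne' with hlt | hlt
  · exact Set.disjoint_left.1 (hgd (x', y') (x, y) hlt) ⟨hv', hvf⟩ hv
  · exact Set.disjoint_left.1 (hgd (x, y) (x', y') hlt) ⟨hv, hvf⟩ hv'

theorem finite_and_encard_dom_lt_of_not_isTopologicalMinor {k : ℕ}
    (hk : ¬ (⊤ : SimpleGraph (Fin k)).IsTopologicalMinor G) (ω : G.Ends) :
    (G.Dom ω).Finite ∧ (G.Dom ω).encard < k := by
  have hlt : (G.Dom ω).encard < k := by
    by_contra hle
    obtain ⟨D, hD, hDk⟩ := Set.exists_subset_encard_eq (not_lt.1 hle)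
    have hDfin : D.Finite := Set.finite_of_encard_eq_coe hDk
    have hcard : hDfin.toFinset.card = k := by
      rw [hDfin.encard_eq_coe_toFinset_card] at hDk
      exact_mod_cast hDk
    let e := (hDfin.toFinset.equivFinOfCardEq hcard).symm
    refine hk (isTopologicalMinor_of_dominates (ω := ω)
      (e.toEmbedding.trans (Function.Embedding.subtype _)) fun x => ?_)
    exact hD (hDfin.mem_toFinset.1 (e x).2)
  exact ⟨Set.finite_of_encard_le_coe hlt.le, hlt⟩

end Domination

/-! ### Sequences of regions around an undominated end -/

section Regions

variable {V : Type*} {G : SimpleGraph V}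

/-- The vertices outside `X` with a neighbour in `X`. -/
def outerNeighbors (G : SimpleGraph V) (X : Set V) : Set V := {v | v ∉ X ∧ ∃ u ∈ X, G.Adj u v}

/-- `S` is a finite set disjoint from `A` that separates `A` from the end of the ray `R`. -/
structure IsTailCut (R : G.Ray) (A S : Set V) : Prop where
  finite : S.Finite
  disjoint : Disjoint S A
  disjoint_tail : Disjoint (R.tailComponent S) A

variable {R : G.Ray} {A S : Set V}

theorem Ray.outerNeighbors_tailComponent_subset (R : G.Ray) (S : Set V) :
    G.outerNeighbors (R.tailComponent S) ⊆ S := by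
  rintro v ⟨hv, u, hu, huv⟩
  by_contra hvS
  exact hv (R.tailComponent_closed S u hu v huv hvS)

theorem Ray.tailComponent_outerNeighbors (R : G.Ray) (hS : S.Finite) :
    R.tailComponent (G.outerNeighbors (R.tailComponent S)) = R.tailComponent S := by
  apply subset_antisymm
  · apply Ray.tailComponent_subset_of_closed
    · intro a ha b hab hb
      by_contra hbS
      exact hb ⟨hbS, a, ha, hab⟩
    · intro n
      obtain ⟨m, hm⟩ := R.exists_mem_tailComponent hS
      exact ⟨max n m, le_max_left _ _, hm _ (le_max_right _ _)⟩
  · exact R.tailComponent_anti (R.outerNeighbors_tailComponent_subset S)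

/-- If no vertex of `A` dominates the end of `R`, then a finite set disjoint from `A` separates `A`
from this end: a tail component in which no vertex of `A` has a neighbour has its neighbourhood
disjoint from `A`. -/
theorem exists_isTailCut (hA : A.Finite)
    (hund : ∀ v ∈ A, ∃ T : Set V, T.Finite ∧ v ∉ T ∧ v ∉ R.tailComponent T) :
    ∃ S, IsTailCut R A S := by
  choose! T hTfin hvT hT using hund
  set U : Set V := A ∪ ⋃ v ∈ A, T v with hU
  have hUfin : U.Finite := hA.union (hA.biUnion hTfin)
  refine ⟨G.outerNeighbors (R.tailComponent U),
    hUfin.subset (R.outerNeighbors_tailComponent_subset U), ?_, ?_⟩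
  · rw [Set.disjoint_left]
    rintro v ⟨-, u, hu, huv⟩ hvA
    have hTU : T v ⊆ U := fun x hx => Or.inr (Set.mem_biUnion hvA hx)
    exact hT v hvA (R.tailComponent_closed (T v) u (R.tailComponent_anti hTU hu) v huv
      (hvT v hvA))
  · rw [R.tailComponent_outerNeighbors hUfin]
    exact (R.disjoint_tailComponent U).mono_right Set.subset_union_left

theorem exists_minimal_isTailCut (h : ∃ S, IsTailCut R A S) : ∃ S, Minimal (IsTailCut R A) S := by
  obtain ⟨S, hS⟩ := h
  obtain ⟨S', hS', hmin⟩ := exists_minimalFor_of_wellFoundedLT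
    (fun S => IsTailCut R A S) (fun S : Set V => S.encard) ⟨S, hS⟩
  refine ⟨S', hS', fun T hT hTS => ?_⟩
  have heq : T = S' :=
    hT.finite.eq_of_subset_of_encard_le hTS (hmin hT (Set.encard_le_encard hTS))
  exact heq.symm.subset

/-- The region cut off by `S` around the end of `R`: the tail component of `R` in `G - S`, together
with `S`. -/
def Ray.cutRegion (R : G.Ray) (S : Set V) : Set V := R.tailComponent S ∪ S

theorem outerNeighbors_eq_of_minimal (hS : Minimal (IsTailCut R A) S) :
    G.outerNeighbors (R.tailComponent S) = S := by
  have hsub := R.outerNeighbors_tailComponent_subset S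
  refine subset_antisymm hsub (hS.2 ⟨hS.1.finite.subset hsub, hS.1.disjoint.mono_left hsub, ?_⟩
    hsub)
  rw [R.tailComponent_outerNeighbors hS.1.finite]
  exact hS.1.disjoint_tail

theorem vertexBoundary_cutRegion_of_minimal (hS : Minimal (IsTailCut R A) S) :
    G.vertexBoundary (R.cutRegion S) = S := by
  apply subset_antisymm
  · rintro v ⟨hv | hv, w, hw, hvw⟩
    · exact absurd (Or.inl (R.tailComponent_closed S v hv w hvw fun h => hw (Or.inr h))) hw
    · exact hv
  · intro s hs
    refine ⟨Or.inr hs, ?_⟩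
    by_contra! hout
    have hsR : s ∉ R.tailComponent S := fun h =>
      Set.disjoint_left.1 (R.disjoint_tailComponent S) h hs
    -- otherwise `S` without `s` would still separate
    have hsub : R.tailComponent (S \ {s}) ⊆ insert s (R.tailComponent S) := by
      apply Ray.tailComponent_subset_of_closed
      · rintro a ha b hab hb
        by_cases hbs : b = s
        · exact Or.inl hbs
        have hbS : b ∉ S := fun h => hb ⟨h, hbs⟩
        rcases ha with rfl | ha
        · by_contra hbR
          exact hout b (fun h => h.elim (fun h => hbR (Or.inr h)) hbS) hab
        · exact Or.inr (R.tailComponent_closed S a ha b hab hbS)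
      · intro n
        obtain ⟨m, hm⟩ := R.exists_mem_tailComponent hS.1.finite
        exact ⟨max n m, le_max_left _ _, Or.inr (hm _ (le_max_right _ _))⟩
    have hcut : IsTailCut R A (S \ {s}) := by
      refine ⟨hS.1.finite.sdiff, hS.1.disjoint.mono_left Set.sdiff_subset, ?_⟩
      refine Set.disjoint_left.2 fun a ha haA => ?_
      rcases hsub ha with rfl | ha
      · exact Set.disjoint_left.1 hS.1.disjoint hs haA
      · exact Set.disjoint_left.1 hS.1.disjoint_tail ha haA
    exact (hS.2 hcut Set.sdiff_subset hs).2 rfl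

theorem toEnd_mem_endsIn_cutRegion (R : G.Ray) (hS : S.Finite) :
    R.toEnd ∈ G.endsIn (R.cutRegion S) := by
  obtain ⟨n, hn⟩ := R.exists_mem_tailComponent hS
  refine ⟨R.drop n, R.drop_toEnd n, ?_⟩
  rintro _ ⟨i, rfl⟩
  exact Or.inl (hn _ (by omega))

theorem isRegion_cutRegion_of_minimal (hS : Minimal (IsTailCut R A) S) :
    G.IsRegion R.toEnd (R.cutRegion S) := by
  refine ⟨?_, toEnd_mem_endsIn_cutRegion R hS.1.finite, ?_⟩
  · obtain ⟨n, hn⟩ := R.exists_mem_tailComponent hS.1.finite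
    have hinner : ∀ u ∈ R.tailComponent S, ∀ v ∈ R.tailComponent S,
        G.JoinedOff (R.cutRegion S)ᶜ u v := fun u hu v hv =>
      (Ray.joinedOff_of_mem_tailComponent hu hv).of_closed (R.tailComponent_closed S)
        (Set.disjoint_compl_right_iff_subset.2 Set.subset_union_left) hu
    have hall : ∀ u ∈ R.cutRegion S, G.JoinedOff (R.cutRegion S)ᶜ u (R.vert n) := by
      rintro u (hu | hu)
      · exact hinner u hu _ (hn n le_rfl)
      · have hu' := hu
        rw [← outerNeighbors_eq_of_minimal hS] at hu'
        obtain ⟨-, w, hw, hwu⟩ := hu'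
        refine (JoinedOff.of_adj hwu.symm ?_ ?_).trans (hinner w hw _ (hn n le_rfl))
        · exact fun h => h (Or.inr hu)
        · exact fun h => h (Or.inl hw)
    have : Nonempty (R.cutRegion S) := ⟨⟨R.vert n, Or.inl (hn n le_rfl)⟩⟩
    refine ⟨?_⟩
    rintro ⟨u, hu⟩ ⟨v, hv⟩
    obtain ⟨p, hp⟩ := (hall u hu).trans (hall v hv).symm
    exact ⟨p.induce _ fun x hx => not_not.1 (hp x hx)⟩
  · rw [vertexBoundary_cutRegion_of_minimal hS]
    exact hS.1.finite

theorem minimal_isEndSeparator_of_minimal (hA : A.Nonempty) (hS : Minimal (IsTailCut R A) S) :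
    Minimal (G.IsEndSeparator A (G.endsIn (R.cutRegion S))) S := by
  refine ⟨⟨?_, ?_⟩, ?_⟩
  · intro hAS
    obtain ⟨a, ha⟩ := hA
    exact Set.disjoint_left.1 hS.1.disjoint (hAS ha) ha
  · rintro D ⟨⟨a, haA, haD⟩, R', ⟨R'', hR'', hsub⟩, hR'D⟩
    obtain ⟨n, hn⟩ := (Ray.toEnd_eq_iff.1 hR'').exists_joinedOff hS.1.finite
    have h1 := hn n n le_rfl le_rfl
    have hmem : R''.vert n ∈ R.tailComponent S :=
      (hsub ⟨n, rfl⟩).resolve_right h1.left_notMem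
    have h2 := ComponentCompl.joinedOff haD (hR'D ⟨n, rfl⟩)
    exact Set.disjoint_left.1 hS.1.disjoint_tail
      ((h2.trans h1.symm).mem_tailComponent hmem) haA
  · intro T hT hTS
    have hTfin : T.Finite := hS.1.finite.subset hTS
    refine hS.2 ⟨hTfin, hS.1.disjoint.mono_left hTS, ?_⟩ hTS
    refine Set.disjoint_left.2 fun a ha haA => ?_
    obtain ⟨n, hn⟩ := ha
    have haT : a ∉ T := (hn n le_rfl).left_notMem
    refine hT.2 (G.componentComplMk haT) ⟨⟨a, haA, haT, rfl⟩, R.drop n, ?_, ?_⟩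
    · rw [R.drop_toEnd]
      exact toEnd_mem_endsIn_cutRegion R hS.1.finite
    · rintro _ ⟨i, rfl⟩
      exact (hn (n + i) (by omega)).mem_componentCompl ⟨haT, rfl⟩

/-- An undominated end is the limit of a sequence of regions that avoid a given finite set and have
non-empty boundaries. Each boundary is a minimal finite set that separates the previous one from
the end. -/
theorem exists_regionsTendTo (R : G.Ray)
    (hund : ∀ v, ∃ T : Set V, T.Finite ∧ v ∉ T ∧ v ∉ R.tailComponent T)
    {F : Set V} (hF : F.Finite) :
    ∃ H : ℕ → Set V, G.RegionsTendTo H R.toEnd ∧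
      ∀ i, Disjoint (H i) F ∧ (G.vertexBoundary (H i)).Nonempty := by
  -- in the first step, a vertex of the ray is separated off to make the boundary non-empty
  set F₀ : Set V := insert (R.vert 0) F with hF₀
  have hstep : ∀ A : Set V, ∃ S, A.Finite → Minimal (IsTailCut R A) S := fun A => by
    by_cases hA : A.Finite
    · obtain ⟨S, hS⟩ := exists_minimal_isTailCut (exists_isTailCut hA fun v _ => hund v)
      exact ⟨S, fun _ => hS⟩
    · exact ⟨∅, fun h => absurd h hA⟩
  choose c hc using hstep
  let S : ℕ → Set V := fun n => n.rec (c F₀) fun _ T => c T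
  have hS0 : Minimal (IsTailCut R F₀) (S 0) := hc F₀ (hF.insert _)
  have hSfin : ∀ n, (S n).Finite := fun n => by
    induction n with
    | zero => exact hS0.1.finite
    | succ n ih => exact (hc (S n) ih).1.finite
  have hS : ∀ n, Minimal (IsTailCut R (S n)) (S (n + 1)) := fun n => hc (S n) (hSfin n)
  have hSmin : ∀ n, ∃ A, Minimal (IsTailCut R A) (S n) := fun n => by
    cases n with
    | zero => exact ⟨_, hS0⟩
    | succ n => exact ⟨_, hS n⟩
  have hbd : ∀ n, G.vertexBoundary (R.cutRegion (S n)) = S n := fun n =>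
    (hSmin n).elim fun A hA => vertexBoundary_cutRegion_of_minimal hA
  -- a cut of a vertex in the component of the ray is non-empty
  have hne : ∀ A T : Set V, IsTailCut R A T → (∃ a ∈ A, a ∈ R.tailComponent ∅) → T.Nonempty := by
    rintro A T hT ⟨a, haA, ha⟩
    rw [Set.nonempty_iff_ne_empty]
    rintro rfl
    exact Set.disjoint_left.1 hT.disjoint_tail ha haA
  have hSne : ∀ n, (S n).Nonempty := fun n => by
    induction n with
    | zero =>
      refine hne _ _ hS0.1 ⟨R.vert 0, Set.mem_insert _ _, 0, fun i _ => ?_⟩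
      exact R.joinedOff (n := 0) (fun _ _ => Set.notMem_empty _) le_rfl (Nat.zero_le i)
    | succ n ih =>
      obtain ⟨A, hA⟩ := hSmin n
      obtain ⟨s, hs⟩ := ih
      refine hne _ _ (hS n).1 ⟨s, hs, ?_⟩
      rw [← outerNeighbors_eq_of_minimal hA] at hs
      obtain ⟨-, u, hu, hus⟩ := hs
      exact R.tailComponent_closed ∅ u (R.tailComponent_anti (Set.empty_subset _) hu) s hus
        (Set.notMem_empty _)
  have hsub : ∀ n, R.cutRegion (S (n + 1)) ⊆ R.tailComponent (S n) := fun n => by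
    have hC : R.tailComponent (S (n + 1)) ⊆ R.tailComponent (S n) :=
      R.tailComponent_subset_of_disjoint (hS n).1.disjoint_tail
    apply Set.union_subset hC
    intro s hs
    have hsn : s ∉ S n := Set.disjoint_left.1 (hS n).1.disjoint hs
    rw [← outerNeighbors_eq_of_minimal (hS n)] at hs
    obtain ⟨-, u, hu, hus⟩ := hs
    exact R.tailComponent_closed _ u (hC hu) s hus hsn
  have hnested : ∀ n, R.cutRegion (S (n + 1)) ⊆ R.cutRegion (S n) \ S n := fun n v hv =>
    ⟨Or.inl (hsub n hv), Set.disjoint_left.1 (R.disjoint_tailComponent _) (hsub n hv)⟩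
  have hanti : StrictAnti fun n => R.cutRegion (S n) := by
    refine strictAnti_nat_of_succ_lt fun n => ?_
    refine ⟨fun v hv => (hnested n hv).1, fun hle => ?_⟩
    obtain ⟨s, hs⟩ := hSne n
    exact (hnested n (hle (Or.inr hs))).2 hs
  refine ⟨fun n => R.cutRegion (S n), ⟨hanti.injective, fun n => ?_, fun n => ?_, fun n => ?_⟩,
    fun n => ⟨?_, ?_⟩⟩
  · obtain ⟨A, hA⟩ := hSmin n
    exact isRegion_cutRegion_of_minimal hA
  · rw [hbd]
    exact hnested n
  · rw [hbd n, hbd (n + 1)]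
    exact minimal_isEndSeparator_of_minimal (hSne n) (hS n)
  · refine Disjoint.mono_left (hanti.antitone (Nat.zero_le n)) ?_
    exact (Set.disjoint_union_left.2 ⟨hS0.1.disjoint_tail, hS0.1.disjoint⟩).mono_right
      (Set.subset_insert _ _)
  · rw [hbd]
    exact hSne n

/-- A region of an end contains a tail of every ray of this end. -/
theorem IsRegion.exists_tail {ω : G.Ends} {H : Set V} (hH : G.IsRegion ω H) {Q : G.Ray}
    (hQ : Q.toEnd = ω) : ∃ n, ∀ i, n ≤ i → Q.vert i ∈ H := by
  obtain ⟨-, ⟨R, hR, hRH⟩, hfin⟩ := hH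
  obtain ⟨n, hn⟩ := (Ray.toEnd_eq_iff.1 (hR.trans hQ.symm)).exists_joinedOff hfin
  refine ⟨n, fun i hi => ?_⟩
  have h := hn n i le_rfl hi
  have hX : ∀ a ∈ H \ G.vertexBoundary H, ∀ b, G.Adj a b → b ∉ G.vertexBoundary H →
      b ∈ H \ G.vertexBoundary H := by
    intro a ha b hab hb
    refine ⟨?_, hb⟩
    by_contra hbH
    exact ha.2 ⟨ha.1, b, hbH, hab⟩
  exact (h.mem_of_closed hX ⟨hRH ⟨n, rfl⟩, h.left_notMem⟩).1

end Regions

/-! ### A finite subgraph of large average degree, or a ray through infinitely many blobs -/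

/-- **Kőnig's lemma** for a digraph with finite out-degrees: if infinitely many vertices can be
reached from `x₀`, then there is an infinite directed path. -/
theorem exists_injective_forall_mem {N : Type*} {next : N → Set N} (hnext : ∀ x, (next x).Finite)
    {x₀ : N} (hinf : {y | Relation.ReflTransGen (fun a b => b ∈ next a) x₀ y}.Infinite) :
    ∃ f : ℕ → N, Function.Injective f ∧ ∀ n, f (n + 1) ∈ next (f n) := by
  -- what can be reached from `x` without entering `U`
  let reach (U : Set N) (x : N) : Set N :=
    {y | Relation.ReflTransGen (fun a b => b ∈ next a ∧ b ∉ U) x y}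
  have hinsert : ∀ U x, reach U x ⊆ reach (insert x U) x := by
    intro U x y hy
    induction hy with
    | refl => exact Relation.ReflTransGen.refl
    | @tail y z _ hyz ih =>
      by_cases hzx : z = x
      · rw [hzx]
        exact Relation.ReflTransGen.refl
      · exact Relation.ReflTransGen.tail ih ⟨hyz.1, by simp [hzx, hyz.2]⟩
  have hstep : ∀ p : {p : N × Set N // (reach p.2 p.1).Infinite},
      ∃ q : {p : N × Set N // (reach p.2 p.1).Infinite},
        q.1.1 ∈ next p.1.1 ∧ q.1.1 ∉ p.1.2 ∧ q.1.2 = insert q.1.1 p.1.2 := by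
    rintro ⟨⟨x, U⟩, hx⟩
    have hcover : reach U x ⊆ {x} ∪ ⋃ y ∈ {y ∈ next x | y ∉ U}, reach U y := by
      intro z hz
      rcases hz.cases_head with rfl | ⟨y, hy, hyz⟩
      · exact Or.inl rfl
      · exact Or.inr (Set.mem_biUnion (show y ∈ {y ∈ next x | y ∉ U} from hy) hyz)
    obtain ⟨y, hy, hyinf⟩ : ∃ y, (y ∈ next x ∧ y ∉ U) ∧ (reach U y).Infinite := by
      by_contra! hall
      refine hx (((Set.finite_singleton x).union (Set.Finite.biUnion ?_ ?_)).subset hcover)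
      · exact (hnext x).subset fun y hy => hy.1
      · exact fun y hy => hall y hy
    exact ⟨⟨(y, insert y U), hyinf.mono (hinsert U y)⟩, hy.1, hy.2, rfl⟩
  choose s hs using hstep
  have h0 : (reach {x₀} x₀).Infinite := by
    have := hinsert ∅ x₀
    simp only [insert_empty_eq] at this
    refine Set.Infinite.mono this ?_
    simpa [reach] using hinf
  let st : ℕ → {p : N × Set N // (reach p.2 p.1).Infinite} :=
    fun n => n.rec ⟨(x₀, {x₀}), h0⟩ fun _ p => s p
  have hmem : ∀ n, (st n).1.1 ∈ (st n).1.2 := by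
    intro n
    cases n with
    | zero => exact rfl
    | succ n =>
      have := (hs (st n)).2.2
      change (s (st n)).1.1 ∈ (s (st n)).1.2
      rw [this]
      exact Set.mem_insert _ _
  have hmono : Monotone fun n => (st n).1.2 := by
    refine monotone_nat_of_le_succ fun n => ?_
    change (st n).1.2 ⊆ (s (st n)).1.2
    rw [(hs (st n)).2.2]
    exact Set.subset_insert _ _
  refine ⟨fun n => (st n).1.1, ?_, fun n => (hs (st n)).1⟩
  have hne : ∀ i j, i < j → (st i).1.1 ≠ (st j).1.1 := by
    intro i j hij heq
    obtain ⟨j, rfl⟩ := Nat.exists_eq_add_of_lt hij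
    refine (hs (st (i + j))).2.1 ?_
    have h1 := hmono (show i ≤ i + j by omega) (hmem i)
    rw [heq] at h1
    exact h1
  intro i j hij
  by_contra hij'
  rcases lt_or_gt_of_ne hij' with h | h
  · exact hne i j h hij
  · exact hne j i h hij.symm

section Blobs

variable {V : Type*} {G : SimpleGraph V}

/-- Paths through disjoint connected sets `X 0, X 1, …`, each joined to the next by an edge, can be
concatenated to a ray that passes through these sets in turn. -/
theorem exists_ray_through {X : ℕ → Set V} (hdisj : ∀ m n, m ≠ n → Disjoint (X m) (X n))
    (hconn : ∀ n, ∀ u ∈ X n, ∀ v ∈ X n, G.JoinedOff (X n)ᶜ u v)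
    (hadj : ∀ n, ∃ u ∈ X n, ∃ v ∈ X (n + 1), G.Adj u v) :
    ∃ (R : G.Ray) (c : ℕ → ℕ), Tendsto c atTop atTop ∧ ∀ t, R.vert t ∈ X (c t) := by
  classical
  choose a ha b hb hab using hadj
  let s : ℕ → V := fun n => n.casesOn (a 0) b
  have hs : ∀ n, s n ∈ X n := fun n => by
    cases n with
    | zero => exact ha 0
    | succ n => exact hb n
  have hpath : ∀ n, ∃ p : G.Path (s n) (a n), ∀ x ∈ p.1.support, x ∈ X n := fun n => by
    obtain ⟨p, hp⟩ := hconn n (s n) (hs n) (a n) (ha n)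
    exact ⟨p.toPath, fun x hx => not_not.1 (hp x (p.support_toPath_subset_support hx))⟩
  choose p hp using hpath
  -- the pair `(n, j)` stands for the vertex number `j` of the path `p n`
  let step : ℕ × ℕ → ℕ × ℕ := fun q =>
    if q.2 < (p q.1).1.length then (q.1, q.2 + 1) else (q.1 + 1, 0)
  let st : ℕ → ℕ × ℕ := fun t => t.rec (0, 0) fun _ q => step q
  let vx : ℕ × ℕ → V := fun q => (p q.1).1.getVert q.2
  have hst : ∀ t, st (t + 1) = step (st t) := fun t => rfl
  have hstep_lt : ∀ q : ℕ × ℕ, q.2 < (p q.1).1.length → step q = (q.1, q.2 + 1) :=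
    fun q h => if_pos h
  have hstep_ge : ∀ q : ℕ × ℕ, ¬ q.2 < (p q.1).1.length → step q = (q.1 + 1, 0) :=
    fun q h => if_neg h
  have hle : ∀ t, (st t).2 ≤ (p (st t).1).1.length := fun t => by
    cases t with
    | zero => exact Nat.zero_le _
    | succ t =>
      rw [hst]
      by_cases h : (st t).2 < (p (st t).1).1.length
      · rw [hstep_lt _ h]
        exact h
      · rw [hstep_ge _ h]
        exact Nat.zero_le _
  have hvx : ∀ t, vx (st t) ∈ X (st t).1 := fun t => hp _ _ (Walk.getVert_mem_support _ _)
  have hstinj : Function.Injective st := by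
    have hmono : StrictMono fun t => toLex (st t) := by
      refine strictMono_nat_of_lt_succ fun t => ?_
      rw [Prod.Lex.toLex_lt_toLex, hst]
      by_cases h : (st t).2 < (p (st t).1).1.length
      · simp [hstep_lt _ h]
      · simp [hstep_ge _ h]
    exact fun i j hij => hmono.injective (congrArg toLex hij)
  have hvxinj : Function.Injective fun t => vx (st t) := by
    intro i j hij
    have h1 : (st i).1 = (st j).1 := by
      by_contra hne
      refine Set.disjoint_left.1 (hdisj _ _ hne) (hvx i) ?_
      simp only at hij
      rw [hij]
      exact hvx j
    refine hstinj (Prod.ext h1 ?_)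
    have hj := hle j
    rw [← h1] at hj
    refine (p (st i).1).2.getVert_injOn (hle i) hj ?_
    simp only [vx] at hij
    rw [hij, h1]
  refine ⟨⟨fun t => vx (st t), hvxinj, fun t => ?_⟩, fun t => (st t).1, ?_, hvx⟩
  · rw [hst]
    by_cases h : (st t).2 < (p (st t).1).1.length
    · rw [hstep_lt _ h]
      exact (p (st t).1).1.adj_getVert_succ h
    · rw [hstep_ge _ h]
      have h' : (st t).2 = (p (st t).1).1.length := le_antisymm (hle t) (not_lt.1 h)
      simp only [vx]
      rw [h', Walk.getVert_length, Walk.getVert_zero]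
      exact hab _
  · rw [tendsto_atTop]
    intro M
    have hfin : {q : ℕ × ℕ | q.1 < M ∧ q.2 ≤ (p q.1).1.length}.Finite := by
      refine ((Set.finite_Iio M).biUnion (t := fun n => {n} ×ˢ Set.Iic (p n).1.length)
        fun n _ => (Set.finite_singleton n).prod (Set.finite_Iic _)).subset ?_
      rintro ⟨n, j⟩ ⟨hn, hj⟩
      exact Set.mem_biUnion (show n ∈ Set.Iio M from hn) ⟨rfl, hj⟩
    rw [← Nat.cofinite_eq_atTop, eventually_cofinite]
    refine (hfin.preimage hstinj.injOn).subset fun t ht => ?_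
    exact ⟨not_le.1 ht, hle t⟩

/-- A finite set of ordered pairs of adjacent vertices of `W` gives a lower bound for the average
degree of the subgraph induced by `W`. -/
theorem lt_averageDegree_induce {W : Finset V} {E : Finset (V × V)} (hW : W.Nonempty)
    (hE : ∀ p ∈ E, p.1 ∈ W ∧ p.2 ∈ W ∧ G.Adj p.1 p.2) {c : ℚ} (hc : c * W.card < E.card) :
    c < ((⊤ : G.Subgraph).induce (W : Set V)).averageDegree := by
  classical
  have hverts : ((⊤ : G.Subgraph).induce (W : Set V)).verts = W := rfl
  rw [Subgraph.averageDegree, hverts, finsum_mem_coe_finset, Set.ncard_coe_finset,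
    lt_div_iff₀ (by exact_mod_cast hW.card_pos)]
  refine hc.trans_le ?_
  rw [Finset.card_eq_sum_card_fiberwise (f := Prod.fst) (t := W) fun p hp => (hE p hp).1]
  push_cast
  refine Finset.sum_le_sum fun v _ => ?_
  have hsub : ((E.filter fun p => p.1 = v).image Prod.snd : Set V) ⊆
      ((⊤ : G.Subgraph).induce (W : Set V)).neighborSet v := by
    intro w hw
    simp only [Finset.coe_image, Finset.coe_filter, Set.mem_image, Set.mem_ofPred_eq] at hw
    obtain ⟨p, ⟨hp, rfl⟩, rfl⟩ := hw
    obtain ⟨h1, h2, h3⟩ := hE p hp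
    exact ⟨h1, h2, h3⟩
  have hfin : (((⊤ : G.Subgraph).induce (W : Set V)).neighborSet v).Finite :=
    W.finite_toSet.subset fun w hw => hw.2.1
  have hcard := Set.ncard_le_ncard hsub hfin
  rw [Set.ncard_coe_finset, Finset.card_image_of_injOn] at hcard
  · exact_mod_cast hcard
  · rintro ⟨u, w⟩ hu ⟨u', w'⟩ hu' h
    simp only [Finset.coe_filter, Set.mem_ofPred_eq] at hu hu' h
    exact Prod.ext (hu.2.trans hu'.2.symm) h

/-- Let disjoint connected sets `X n` ("blobs") with finite cores `C n ⊆ X n` be given, and for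
each `n` a set `E n` of more than `c * |C n|` edges from `C n` to the cores. Starting from one blob
and adding again and again the blobs to which the chosen edges lead, one arrives at finitely many
blobs, whose cores induce a subgraph of average degree more than `c`, or else Kőnig's lemma gives a
ray that leaves every blob. -/
theorem exists_averageDegree_or_ray {N : Type*} [Nonempty N] {X : N → Set V} {C : N → Finset V}
    {E : N → Finset (V × V)} {c : ℚ} (hdisj : ∀ m n, m ≠ n → Disjoint (X m) (X n))
    (hconn : ∀ n, ∀ u ∈ X n, ∀ v ∈ X n, G.JoinedOff (X n)ᶜ u v)
    (hCX : ∀ n, ∀ v ∈ C n, v ∈ X n) (hC : ∀ n, (C n).Nonempty)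
    (hE : ∀ n, ∀ p ∈ E n, p.1 ∈ C n ∧ G.Adj p.1 p.2 ∧ ∃ n', p.2 ∈ C n')
    (hcard : ∀ n, c * (C n).card < (E n).card) :
    (∃ H : G.Subgraph, H.verts.Finite ∧ H.verts.Nonempty ∧ c < H.averageDegree) ∨
      ∃ R : G.Ray, ∀ n i, ∃ j, i ≤ j ∧ R.vert j ∉ X n := by
  classical
  obtain ⟨x₀⟩ := ‹Nonempty N›
  have hCdisj : ∀ m n v, v ∈ C m → v ∈ C n → m = n := by
    intro m n v hm hn
    by_contra hne
    exact Set.disjoint_left.1 (hdisj m n hne) (hCX m v hm) (hCX n v hn)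
  let next : N → Set N := fun n => {n' | ∃ p ∈ E n, p.2 ∈ C n'}
  have hnext : ∀ n, (next n).Finite := by
    intro n
    refine ((E n).finite_toSet.biUnion (t := fun p => {n' | p.2 ∈ C n'})
      fun p _ => Set.Subsingleton.finite fun a ha b hb => hCdisj a b _ ha hb).subset ?_
    rintro n' ⟨p, hp, hpn'⟩
    exact Set.mem_biUnion (Finset.mem_coe.2 hp) hpn'
  by_cases hfin : {y | Relation.ReflTransGen (fun a b => b ∈ next a) x₀ y}.Finite
  · left
    set D := hfin.toFinset with hD
    have hmemD : ∀ n, n ∈ D ↔ Relation.ReflTransGen (fun a b => b ∈ next a) x₀ n :=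
      fun n => hfin.mem_toFinset
    have hx₀ : x₀ ∈ D := (hmemD x₀).2 Relation.ReflTransGen.refl
    have hW : (D.biUnion C).Nonempty :=
      (hC x₀).mono (Finset.subset_biUnion_of_mem C hx₀)
    refine ⟨(⊤ : G.Subgraph).induce ↑(D.biUnion C), (D.biUnion C).finite_toSet, hW,
      lt_averageDegree_induce (E := D.biUnion E) hW ?_ ?_⟩
    · intro p hp
      obtain ⟨n, hn, hp⟩ := Finset.mem_biUnion.1 hp
      obtain ⟨h1, h2, n', h3⟩ := hE n p hp
      refine ⟨Finset.mem_biUnion.2 ⟨n, hn, h1⟩, Finset.mem_biUnion.2 ⟨n', ?_, h3⟩, h2⟩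
      exact (hmemD n').2 (((hmemD n).1 hn).tail ⟨p, hp, h3⟩)
    · rw [Finset.card_biUnion, Finset.card_biUnion]
      · push_cast
        rw [Finset.mul_sum]
        exact Finset.sum_lt_sum_of_nonempty ⟨x₀, hx₀⟩ fun n _ => hcard n
      · intro m _ n _ hne
        refine Finset.disjoint_left.2 fun p hm hn => hne ?_
        exact hCdisj m n p.1 (hE m p hm).1 (hE n p hn).1
      · intro m _ n _ hne
        exact Finset.disjoint_left.2 fun v hm hn => hne (hCdisj m n v hm hn)
  · right
    obtain ⟨f, hf, hfnext⟩ := exists_injective_forall_mem hnext hfin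
    obtain ⟨R, d, hd, hR⟩ := exists_ray_through (G := G) (X := fun n => X (f n))
      (fun m n hmn => hdisj _ _ (hf.ne hmn)) (fun n => hconn (f n)) fun n => by
        obtain ⟨p, hp, hp2⟩ := hfnext n
        obtain ⟨h1, h2, -⟩ := hE _ p hp
        exact ⟨p.1, hCX _ _ h1, p.2, hCX _ _ hp2, h2⟩
    refine ⟨R, fun n i => ?_⟩
    by_contra! hall
    have hfd : ∀ j, i ≤ j → f (d j) = n := by
      intro j hj
      by_contra hne
      exact Set.disjoint_left.1 (hdisj _ _ hne) (hR j) (hall j hj)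
    obtain ⟨j, hij, hj⟩ := ((tendsto_atTop.1 hd (d i + 1)).and (eventually_ge_atTop i)).exists
    have := hf ((hfd j hj).trans (hfd i le_rfl).symm)
    omega

end Blobs

/-! ### Cutting off an end of large relative degree -/

section EndCuts

variable {V : Type*} {G : SimpleGraph V}

theorem exists_edges_of_lt_boundaryRatio {H : Set V} {c : ℚ} (hc : 0 ≤ c)
    (hfin : (G.vertexBoundary H).Finite) (hne : (G.vertexBoundary H).Nonempty)
    (h : ENNReal.ofReal c < G.boundaryRatio H) :
    ∃ E : Finset (V × V), (∀ p ∈ E, p.1 ∈ G.vertexBoundary H ∧ p.2 ∉ H ∧ G.Adj p.1 p.2) ∧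
      c * (hfin.toFinset.card : ℚ) < E.card := by
  classical
  set b := hfin.toFinset.card with hb
  have hbpos : 0 < b := Finset.card_pos.2 (by simpa using hne)
  have hbcard : (G.vertexBoundary H).encard = b := hfin.encard_eq_coe_toFinset_card
  rw [boundaryRatio, hbcard, ENat.toENNReal_coe, ENNReal.lt_div_iff_mul_lt
    (Or.inl (by exact_mod_cast hbpos.ne')) (Or.inl (ENNReal.natCast_ne_top b))] at h
  have hcb : (0 : ℚ) ≤ c * b := by positivity
  obtain ⟨t, ht, htE⟩ : ∃ t : ℕ, c * b < t ∧ (t : ℕ∞) ≤ (G.edgeBoundary H).encard := by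
    refine ⟨⌊c * b⌋₊ + 1, by exact_mod_cast Nat.lt_floor_add_one (c * (b : ℚ)), ?_⟩
    have hfloor : ((⌊c * b⌋₊ : ℕ) : ℝ≥0∞) ≤ ENNReal.ofReal c * b := by
      rw [← ENNReal.ofReal_natCast b, ← ENNReal.ofReal_mul (by exact_mod_cast hc),
        ← ENNReal.ofReal_natCast]
      refine ENNReal.ofReal_le_ofReal ?_
      exact_mod_cast Nat.floor_le hcb
    have hlt : ((⌊c * b⌋₊ : ℕ) : ℕ∞) < (G.edgeBoundary H).encard := by
      rw [← ENat.toENNReal_lt, ENat.toENNReal_coe]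
      exact hfloor.trans_lt h
    rw [Nat.cast_add_one]
    exact Order.add_one_le_of_lt hlt
  obtain ⟨S, hS, hSt⟩ := Set.exists_subset_encard_eq htE
  have hSfin : S.Finite := Set.finite_of_encard_eq_coe hSt
  have hdart : ∀ e : S, ∃ p : V × V, (p.1 ∈ H ∧ p.2 ∉ H ∧ G.Adj p.1 p.2) ∧ s(p.1, p.2) = e.1 := by
    rintro ⟨e, he⟩
    obtain ⟨v, w, hv, hw, hvw, rfl⟩ := hS he
    exact ⟨(v, w), ⟨hv, hw, hvw⟩, rfl⟩
  choose d hd hde using hdart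
  have hdinj : Function.Injective d := fun e e' h => by
    apply Subtype.ext
    rw [← hde, ← hde, h]
  have : Fintype S := hSfin.fintype
  refine ⟨Finset.univ.image d, ?_, ?_⟩
  · intro p hp
    obtain ⟨e, -, rfl⟩ := Finset.mem_image.1 hp
    obtain ⟨h1, h2, h3⟩ := hd e
    exact ⟨⟨h1, _, h2, h3⟩, h2, h3⟩
  · rw [Finset.card_image_of_injective _ hdinj, Finset.card_univ]
    have hcard : Fintype.card S = t := by
      rw [Set.encard_eq_coe_toFinset_card, Set.toFinset_card] at hSt
      exact_mod_cast hSt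
    rw [hcard]
    exact ht

/-- Around an undominated end whose limit ratio exceeds `c` there are regions that avoid a given
finite set and have boundary ratio more than `c`. -/
theorem exists_region_of_lt_limitRatio (R : G.Ray)
    (hund : ∀ v, ∃ T : Set V, T.Finite ∧ v ∉ T ∧ v ∉ R.tailComponent T) {c : ℝ≥0∞}
    (hc : c < G.limitRatio R.toEnd) {F : Set V} (hF : F.Finite) :
    ∃ H, G.IsRegion R.toEnd H ∧ Disjoint H F ∧ (G.vertexBoundary H).Nonempty ∧
      c < G.boundaryRatio H := by
  obtain ⟨H, hH, hHF⟩ := exists_regionsTendTo R hund hF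
  have hlim : c < liminf (fun i => G.boundaryRatio (H i)) atTop :=
    hc.trans_le (iInf₂_le H hH)
  obtain ⟨i, hi⟩ := (eventually_lt_of_lt_liminf hlim).exists
  exact ⟨H i, hH.region i, (hHF i).1, (hHF i).2, hi⟩

/-- The data with which an end is cut off: a set of vertices (the region), some of its vertices
(the core, through which it is attached to the rest of the graph), and edges from the core to the
outside, as ordered pairs. -/
structure EndCut (V : Type*) where
  region : Set V
  core : Finset V
  edges : Finset (V × V)

/-- `K` cuts off the end `ω`: its region is a region of `G - Dom(ω)` which contains tails of all
rays of `ω`, its core is the vertex-boundary of the region in `G - Dom(ω)`, and it has more than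
`c` times as many edges as core vertices. -/
structure EndCut.CutsOff (G : SimpleGraph V) (c : ℚ) (ω : G.Ends) (K : EndCut V) : Prop where
  joinedOff : ∀ u ∈ K.region, ∀ v ∈ K.region, G.JoinedOff K.regionᶜ u v
  disjoint_dom : Disjoint K.region (G.Dom ω)
  core_subset : ∀ v ∈ K.core, v ∈ K.region
  core_nonempty : K.core.Nonempty
  closed : ∀ v ∈ K.region, v ∉ K.core → ∀ w, G.Adj v w → w ∈ K.region ∨ w ∈ G.Dom ω
  edges_spec : ∀ p ∈ K.edges, p.1 ∈ K.core ∧ p.2 ∉ K.region ∧ G.Adj p.1 p.2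
  lt_card : c * K.core.card < K.edges.card
  tail : ∀ R : G.Ray, R.toEnd = ω → ∃ n, ∀ i, n ≤ i → R.vert i ∈ K.region

/-- A ray of `G` all of whose vertices lie in `s`, as a ray of the subgraph induced by `s`. -/
def Ray.toInduce {s : Set V} (R : G.Ray) (h : ∀ i, R.vert i ∈ s) : (G.induce s).Ray where
  vert i := ⟨R.vert i, h i⟩
  inj _ _ hij := R.inj (congrArg Subtype.val hij)
  adj i := R.adj i

theorem JoinedOff.of_induce {s : Set V} {T : Set s} {u v : s}
    (h : (G.induce s).JoinedOff T u v) {T' : Set V} (hT : ∀ x : s, x ∉ T → (x : V) ∉ T') :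
    G.JoinedOff T' u v := by
  obtain ⟨p, hp⟩ := h
  refine ⟨p.map (Embedding.induce s).toHom, fun x hx => ?_⟩
  have hx' := (Walk.support_map (Embedding.induce s).toHom p) ▸ hx
  obtain ⟨y, hy, rfl⟩ := List.mem_map.1 hx'
  exact hT y (hp y hy)

/-- If `Dom(ω)` is finite, then every ray of `ω` has a tail in `G_ω`, which belongs to the
end `ω̂`. -/
theorem exists_drop_toInduce {ω : G.Ends} (hfin : (G.Dom ω).Finite) {R : G.Ray}
    (hR : R.toEnd = ω) : ∃ (n : ℕ) (h : ∀ i, (R.drop n).vert i ∈ (G.Dom ω)ᶜ),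
      G.IsHatEnd ω ((R.drop n).toInduce h).toEnd := by
  obtain ⟨n, -, hn⟩ := R.exists_avoid hfin 0
  refine ⟨n, fun i => hn (n + i) (by omega), _, rfl, ?_⟩
  exact (R.drop_toEnd n).trans hR

theorem exists_cutsOff {ω : G.Ends} (hfin : (G.Dom ω).Finite) {c : ℚ} (hc : 0 ≤ c)
    (hlim : ∀ η, G.IsHatEnd ω η → ENNReal.ofReal c < (G.undominated ω).limitRatio η)
    {F : Set V} (hF : F.Finite) :
    ∃ K : EndCut V, K.CutsOff G c ω ∧ Disjoint K.region F := by
  classical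
  obtain ⟨R₀, hR₀⟩ := Quotient.exists_rep ω
  obtain ⟨n₀, hn₀, hat⟩ := exists_drop_toInduce hfin (R := R₀) hR₀
  set R := (R₀.drop n₀).toInduce hn₀ with hR
  have hRω : R.ofInduce.toEnd = ω := hR₀ ▸ R₀.drop_toEnd n₀
  -- no vertex of `G_ω` dominates the end of `R`, as it would also dominate `ω` in `G`
  have hund : ∀ v, ∃ T : Set ↥(G.Dom ω)ᶜ, T.Finite ∧ v ∉ T ∧ v ∉ R.tailComponent T := by
    intro v
    by_contra! hall
    have hdom : G.Dominates v R.ofInduce.toEnd → False := fun h => by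
      rw [hRω] at h
      exact v.2 h
    refine hdom (dominates_of_mem_tailComponent fun T hT hvT => ?_)
    obtain ⟨n, hn⟩ := hall (Subtype.val ⁻¹' T) (hT.preimage Subtype.val_injective.injOn) hvT
    exact ⟨n, fun i hi => (hn i hi).of_induce fun x hx => hx⟩
  obtain ⟨H, hH, hHF, hne, hratio⟩ := exists_region_of_lt_limitRatio R hund (hlim _ hat)
    (F := Subtype.val ⁻¹' F) (hF.preimage Subtype.val_injective.injOn)
  obtain ⟨E, hE, hcard⟩ := exists_edges_of_lt_boundaryRatio hc hH.2.2 hne hratio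
  let ι : ↥(G.Dom ω)ᶜ ↪ V := Function.Embedding.subtype _
  refine ⟨⟨Subtype.val '' H, hH.2.2.toFinset.map ι, E.map (ι.prodMap ι)⟩, ⟨?_, ?_, ?_, ?_, ?_, ?_, ?_,
    ?_⟩, ?_⟩
  · rintro _ ⟨u, hu, rfl⟩ _ ⟨v, hv, rfl⟩
    have h : (G.undominated ω).JoinedOff Hᶜ u v := by
      obtain ⟨p⟩ := hH.1.preconnected ⟨u, hu⟩ ⟨v, hv⟩
      refine JoinedOff.of_induce (T := ∅) ⟨p, fun _ _ => Set.notMem_empty _⟩ ?_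
      exact fun x _ hx => hx x.2
    exact h.of_induce fun x hx hx' => hx' ⟨x, not_not.1 hx, rfl⟩
  · rw [Set.disjoint_left]
    rintro _ ⟨v, -, rfl⟩
    exact v.2
  · intro u hu
    obtain ⟨v, hv, rfl⟩ := Finset.mem_map.1 hu
    exact ⟨v, (hH.2.2.mem_toFinset.1 hv).1, rfl⟩
  · simpa using hne
  · rintro _ ⟨v, hv, rfl⟩ hvB w hvw
    by_contra! hw
    refine hvB (Finset.mem_map.2 ⟨v, hH.2.2.mem_toFinset.2 ⟨hv, ⟨w, hw.2⟩, ?_, hvw⟩, rfl⟩)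
    exact fun h => hw.1 ⟨_, h, rfl⟩
  · intro q hq
    obtain ⟨p, hp, rfl⟩ := Finset.mem_map.1 hq
    obtain ⟨h1, h2, h3⟩ := hE p hp
    refine ⟨Finset.mem_map.2 ⟨p.1, hH.2.2.mem_toFinset.2 h1, rfl⟩, ?_, h3⟩
    rintro ⟨x, hx, hxp⟩
    obtain rfl := Subtype.val_injective hxp
    exact h2 hx
  · simpa using hcard
  · intro Q hQ
    obtain ⟨n, hn, hat'⟩ := exists_drop_toInduce hfin hQ
    obtain ⟨m, hm⟩ := hH.exists_tail (IsHatEnd.unique G hfin hat' hat)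
    refine ⟨n + m, fun i hi => ⟨_, hm (i - n) (by omega), ?_⟩⟩
    change Q.vert (n + (i - n)) = _
    congr 1
    omega
  · rw [Set.disjoint_left]
    rintro _ ⟨v, hv, rfl⟩ hvF
    exact Set.disjoint_left.1 hHF hv hvF

/-- If fewer than `k` vertices dominate an end of relative degree more than `m`, then its limit ratio
exceeds `m - k + 1`. -/
theorem lt_limitRatio_of_lt_relativeDegree {ω : G.Ends} {k : ℕ} {m : ℚ}
    (hfin : (G.Dom ω).Finite) (hk : (G.Dom ω).encard < k)
    (hm : ((m : ℝ) : EReal) < (G.relativeDegree ω : EReal)) (η : (G.undominated ω).Ends)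
    (hη : G.IsHatEnd ω η) (hc : 0 ≤ m - k + 1) :
    ENNReal.ofReal (m - k + 1 : ℚ) < (G.undominated ω).limitRatio η := by
  have hex : (G.Dom ω).Finite ∧ ∃ η, G.IsHatEnd ω η := ⟨hfin, η, hη⟩
  rw [relativeDegree, dif_pos hex, IsHatEnd.unique G hfin hex.2.choose_spec hη] at hm
  obtain ⟨d, hd⟩ := ENat.ne_top_iff_exists.1 hk.ne_top
  rw [← hd] at hk hm
  have hdk : d < k := by exact_mod_cast hk
  have hdk' : (d : ℝ) + 1 ≤ k := by exact_mod_cast hdk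
  by_contra hle
  have hle' := not_lt.1 hle
  have hsum : ((d : ℕ∞) : ℝ≥0∞) + (G.undominated ω).limitRatio η ≤ ENNReal.ofReal m := by
    calc ((d : ℕ∞) : ℝ≥0∞) + (G.undominated ω).limitRatio η
        ≤ ENNReal.ofReal d + ENNReal.ofReal (m - k + 1 : ℚ) := by
          refine add_le_add ?_ hle'
          simp
      _ = ENNReal.ofReal (d + (m - k + 1 : ℚ)) :=
          (ENNReal.ofReal_add (by positivity) (by exact_mod_cast hc)).symm
      _ ≤ ENNReal.ofReal m := by
          refine ENNReal.ofReal_le_ofReal ?_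
          push_cast
          linarith
  have hm0 : (0 : ℝ) ≤ m := by
    have : (0 : ℝ) ≤ m - k + 1 := by exact_mod_cast hc
    have hd0 : (0 : ℝ) ≤ d := Nat.cast_nonneg d
    linarith
  have := hm.trans_le (EReal.coe_ennreal_le_coe_ennreal_iff.2 hsum)
  rw [EReal.coe_ennreal_ofReal, max_eq_left hm0] at this
  exact lt_irrefl _ this

end EndCuts

/-! ### Cutting off all ends -/

section CuttingOff

variable {V : Type*} {G : SimpleGraph V}

/-- Cuts for all ends can be chosen one after the other such that the region of each avoids the
cores and the edges of the earlier ones as well as the vertices dominating the earlier ends; and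
each vertex `v` that dominates an end keeps its set `N v` of neighbours when this end is cut off. -/
theorem exists_forall_cutsOff [Countable G.Ends] {c : ℚ} (N : V → Finset V)
    (hDom : ∀ ω, (G.Dom ω).Finite)
    (hcut : ∀ ω (F : Set V), F.Finite → ∃ K : EndCut V, K.CutsOff G c ω ∧ Disjoint K.region F) :
    ∃ (e : G.Ends → ℕ) (K : G.Ends → EndCut V), Function.Injective e ∧
      (∀ ω, (K ω).CutsOff G c ω) ∧ (∀ ω, ∀ v ∈ G.Dom ω, ∀ w ∈ N v, w ∉ (K ω).region) ∧
      ∀ ω ω', e ω' < e ω → (∀ v ∈ (K ω').core, v ∉ (K ω).region) ∧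
        (∀ p ∈ (K ω').edges, p.2 ∉ (K ω).region) ∧ Disjoint (K ω).region (G.Dom ω') := by
  obtain ⟨e, he⟩ := Countable.exists_injective_nat G.Ends
  obtain ⟨K, hK, hKd⟩ := exists_avoiding_choice (V := V) (α := fun _ : G.Ends => EndCut V) e he
    (fun ω K => K.CutsOff G c ω ∧ ∀ v ∈ G.Dom ω, ∀ w ∈ N v, w ∉ K.region)
    (fun _ K => K.region)
    (fun ω K => (K.core ∪ Prod.snd '' (K.edges : Set (V × V))) ∪ G.Dom ω)
    (fun ω K _ => (K.core.finite_toSet.union (K.edges.finite_toSet.image _)).union (hDom ω)) (by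
      intro ω F hF
      obtain ⟨K, hK, hKF⟩ := hcut ω (F ∪ ⋃ v ∈ G.Dom ω, (N v : Set V))
        (hF.union ((hDom ω).biUnion fun v _ => (N v).finite_toSet))
      rw [Set.disjoint_union_right] at hKF
      refine ⟨K, ⟨hK, fun v hv w hw hwK => ?_⟩, hKF.1⟩
      exact Set.disjoint_left.1 hKF.2 hwK (Set.mem_biUnion hv hw))
  refine ⟨e, K, he, fun ω => (hK ω).1, fun ω => (hK ω).2, fun ω ω' h => ?_⟩
  have hd := hKd ω ω' h
  rw [Set.disjoint_union_right, Set.disjoint_union_right] at hd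
  exact ⟨fun v hv hv' => Set.disjoint_left.1 hd.1.1 hv' hv,
    fun p hp hp' => Set.disjoint_left.1 hd.1.2 hp' ⟨p, hp, rfl⟩, hd.2⟩

/-- If every vertex has degree more than `c` and every end can be cut off with a boundary ratio of
more than `c`, far away from any finite set, then some finite subgraph has average degree more
than `c`. -/
theorem exists_averageDegree_of_cutsOff [Nonempty V] [Countable G.Ends] {c : ℚ} (N : V → Finset V)
    (hN : ∀ v, ∀ w ∈ N v, G.Adj v w) (hNcard : ∀ v, c < (N v).card)
    (hDom : ∀ ω, (G.Dom ω).Finite)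
    (hcut : ∀ ω (F : Set V), F.Finite → ∃ K : EndCut V, K.CutsOff G c ω ∧ Disjoint K.region F) :
    ∃ H : G.Subgraph, H.verts.Finite ∧ H.verts.Nonempty ∧ c < H.averageDegree := by
  classical
  obtain ⟨e, K, he, hK, hKN, hKK⟩ := exists_forall_cutsOff N hDom hcut
  -- the regions are laminar: later ones lie inside or outside the earlier ones
  have hlam : ∀ ω ω', e ω' < e ω →
      (K ω).region ⊆ (K ω').region ∨ Disjoint (K ω).region (K ω').region := by
    intro ω ω' h
    obtain ⟨h1, -, h3⟩ := hKK ω ω' h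
    by_contra! hcon
    obtain ⟨hsub, hdis⟩ := hcon
    obtain ⟨u, hu, hu'⟩ := Set.not_disjoint_iff.1 hdis
    refine hsub fun v hv => ?_
    refine (JoinedOff.mem_of_closed (X := (K ω').region ∩ (K ω).region) ?_
      ((hK ω).joinedOff u hu v hv) ⟨hu', hu⟩).1
    rintro a ⟨ha', ha⟩ b hab hb
    have hb : b ∈ (K ω).region := not_not.1 hb
    refine ⟨?_, hb⟩
    exact ((hK ω').closed a ha' (fun h => h1 a h ha) b hab).resolve_right
      (Set.disjoint_left.1 h3 hb)
  let I : Set G.Ends := {ω | ∀ ω', e ω' < e ω → Disjoint (K ω).region (K ω').region}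
  have hI : ∀ ω ∈ I, ∀ ω' ∈ I, ω ≠ ω' → Disjoint (K ω).region (K ω').region := by
    intro ω hω ω' hω' hne
    rcases lt_or_gt_of_ne (he.ne hne) with h | h
    · exact (hω' ω h).symm
    · exact hω ω' h
  have hmax : ∀ n ω, e ω = n → ∃ ω' ∈ I, (K ω).region ⊆ (K ω').region := by
    intro n
    induction n using Nat.strong_induction_on with
    | _ n ih =>
      rintro ω rfl
      by_cases hω : ω ∈ I
      · exact ⟨ω, hω, subset_rfl⟩
      · obtain ⟨ω', hlt, hnd⟩ : ∃ ω', e ω' < e ω ∧ ¬ Disjoint (K ω).region (K ω').region := by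
          simpa [I] using hω
        obtain ⟨ω'', hω'', hsub⟩ := ih _ hlt ω' rfl
        exact ⟨ω'', hω'', ((hlam ω ω' hlt).resolve_right hnd).trans hsub⟩
  let M := {v : V // ∀ ω ∈ I, v ∉ (K ω).region} ⊕ I
  let X : M → Set V := Sum.elim (fun v => {v.1}) fun ω => (K ω.1).region
  let C : M → Finset V := Sum.elim (fun v => {v.1}) fun ω => (K ω.1).core
  let E : M → Finset (V × V) := Sum.elim (fun v => (N v.1).image (Prod.mk v.1))
    fun ω => (K ω.1).edges
  -- a vertex is in a core unless it is in a region but not in the core of this region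
  have hcore : ∀ w, (∀ ω ∈ I, w ∈ (K ω).region → w ∈ (K ω).core) → ∃ n, w ∈ C n := by
    intro w hw
    by_cases hwI : ∀ ω ∈ I, w ∉ (K ω).region
    · exact ⟨Sum.inl ⟨w, hwI⟩, Finset.mem_singleton_self w⟩
    · push Not at hwI
      obtain ⟨ω, hω, hwω⟩ := hwI
      exact ⟨Sum.inr ⟨ω, hω⟩, hw ω hω hwω⟩
  have : Nonempty M := by
    obtain ⟨v⟩ := ‹Nonempty V›
    by_cases hv : ∀ ω ∈ I, v ∉ (K ω).region
    · exact ⟨Sum.inl ⟨v, hv⟩⟩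
    · push Not at hv
      obtain ⟨ω, hω, -⟩ := hv
      exact ⟨Sum.inr ⟨ω, hω⟩⟩
  have hray := exists_averageDegree_or_ray (G := G) (X := X) (C := C) (E := E) (c := c)
    ?_ ?_ ?_ ?_ ?_ ?_
  · refine hray.resolve_right ?_
    rintro ⟨R, hR⟩
    obtain ⟨n, hn⟩ := (hK R.toEnd).tail R rfl
    obtain ⟨ω, hω, hsub⟩ := hmax _ R.toEnd rfl
    obtain ⟨j, hj, hRj⟩ := hR (Sum.inr ⟨ω, hω⟩) n
    exact hRj (hsub (hn j hj))
  · rintro (⟨v, hv⟩ | ⟨ω, hω⟩) (⟨v', hv'⟩ | ⟨ω', hω'⟩) hne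
    · refine Set.disjoint_singleton.2 fun h => hne ?_
      simp only at h
      subst h
      rfl
    · exact Set.disjoint_singleton_left.2 (hv ω' hω')
    · exact Set.disjoint_singleton_right.2 (hv' ω hω)
    · refine hI ω hω ω' hω' fun h => hne ?_
      subst h
      rfl
  · rintro (⟨v, hv⟩ | ⟨ω, hω⟩) u hu u' hu'
    · obtain rfl : u = v := hu
      obtain rfl : u' = u := hu'
      exact JoinedOff.refl fun h => h rfl
    · exact (hK ω).joinedOff u hu u' hu'
  · rintro (⟨v, hv⟩ | ⟨ω, hω⟩) u hu
    · exact Finset.mem_singleton.1 hu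
    · exact (hK ω).core_subset u hu
  · rintro (⟨v, hv⟩ | ⟨ω, hω⟩)
    · exact Finset.singleton_nonempty v
    · exact (hK ω).core_nonempty
  · rintro (⟨v, hv⟩ | ⟨ω, hω⟩) p hp
    · obtain ⟨w, hw, rfl⟩ := Finset.mem_image.1 hp
      refine ⟨Finset.mem_singleton_self v, hN v w hw, hcore w fun ω hω hwω => ?_⟩
      -- only a vertex dominating `ω` can lose neighbours when `ω` is cut off
      by_contra hwc
      rcases (hK ω).closed w hwω hwc v (hN v w hw).symm with h | h
      · exact hv ω hω h
      · exact hKN ω v h w hw hwω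
    · obtain ⟨h1, h2, h3⟩ := (hK ω).edges_spec p hp
      refine ⟨h1, h3, hcore p.2 fun ω' hω' hpω' => ?_⟩
      by_contra hpc
      have hp1 := (hK ω).core_subset _ h1
      have hne : ω ≠ ω' := by
        rintro rfl
        exact h2 hpω'
      rcases (hK ω').closed p.2 hpω' hpc p.1 h3.symm with h | h
      · exact Set.disjoint_left.1 (hI ω hω ω' hω' hne) hp1 h
      · rcases lt_or_gt_of_ne (he.ne hne) with hlt | hlt
        · exact (hKK ω' ω hlt).2.1 p hp hpω'
        · exact Set.disjoint_left.1 (hKK ω ω' hlt).2.2 hp1 h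
  · rintro (⟨v, hv⟩ | ⟨ω, hω⟩)
    · have himg : ((N v).image (Prod.mk v)).card = (N v).card :=
        Finset.card_image_of_injective _ fun a b h => (Prod.mk.inj h).2
      simpa [C, E, himg] using hNcard v
    · exact (hK ω).lt_card

theorem exists_finset_neighbors {v : V} {c : ℚ}
    (h : ((c : ℝ) : EReal) < (G.vertexDegree v : EReal)) :
    ∃ N : Finset V, (∀ w ∈ N, G.Adj v w) ∧ c < N.card := by
  obtain ⟨t, hct, ht⟩ : ∃ t : ℕ, c < t ∧ (t : ℕ∞) ≤ (G.neighborSet v).encard := by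
    by_cases hfin : (G.neighborSet v).Finite
    · refine ⟨hfin.toFinset.card, ?_, hfin.encard_eq_coe_toFinset_card.ge⟩
      rw [vertexDegree, hfin.encard_eq_coe_toFinset_card, ENat.toENNReal_coe,
        ← ENNReal.ofReal_natCast, EReal.coe_ennreal_ofReal, max_eq_left (Nat.cast_nonneg _)] at h
      exact_mod_cast EReal.coe_lt_coe_iff.1 h
    · obtain ⟨t, ht⟩ := exists_nat_gt c
      refine ⟨t, ht, ?_⟩
      rw [Set.not_finite.1 hfin |>.encard_eq]
      exact le_top
  obtain ⟨S, hS, hSt⟩ := Set.exists_subset_encard_eq ht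
  have hSfin : S.Finite := Set.finite_of_encard_eq_coe hSt
  refine ⟨hSfin.toFinset, fun w hw => hS (hSfin.mem_toFinset.1 hw), ?_⟩
  rw [hSfin.encard_eq_coe_toFinset_card] at hSt
  have : hSfin.toFinset.card = t := by exact_mod_cast hSt
  rwa [this]

theorem isTopologicalMinor_top_of_le_one [Nonempty V] {k : ℕ} (hk : k ≤ 1) :
    (⊤ : SimpleGraph (Fin k)).IsTopologicalMinor G := by
  have : Subsingleton (Fin k) := Fin.subsingleton_iff_le_one.2 hk
  have hno : ∀ x y : Fin k, ¬ (⊤ : SimpleGraph (Fin k)).Adj x y := fun x y h =>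
    h.ne (Subsingleton.elim x y)
  exact ⟨⟨fun _ => Classical.arbitrary V, fun x y _ => Subsingleton.elim x y⟩,
    fun x y h => absurd h (hno x y), fun x y h => absurd h (hno x y),
    fun x y h => absurd h (hno x y)⟩

end CuttingOff

end SimpleGraph

theorem theorem3 {V : Type*} [Nonempty V] (G : SimpleGraph V) (k : ℕ) (m : ℚ)
    (hΩ : Countable G.Ends) (hδ : G.MinDegreeGT m) :
    (⊤ : SimpleGraph (Fin k)).IsTopologicalMinor G ∨
      ∃ H : G.Subgraph, H.verts.Finite ∧ H.verts.Nonempty ∧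
        m - (k : ℚ) + 1 < H.averageDegree := by
  rw [or_iff_not_imp_left]
  intro hk
  have hk1 : 1 < k := by
    by_contra hle
    exact hk (SimpleGraph.isTopologicalMinor_top_of_le_one (not_lt.1 hle))
  have hdom := SimpleGraph.finite_and_encard_dom_lt_of_not_isTopologicalMinor hk
  have hcm : m - (k : ℚ) + 1 ≤ m := by
    have : (1 : ℚ) < k := by exact_mod_cast hk1
    linarith
  have hdeg : ∀ v, ∃ N : Finset V, (∀ w ∈ N, G.Adj v w) ∧ m < N.card := fun v =>
    SimpleGraph.exists_finset_neighbors (hδ.1 v)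
  choose N hN hNcard using hdeg
  rcases lt_or_ge (m - (k : ℚ) + 1) 0 with hneg | hnonneg
  · -- every average degree is at least `0`
    obtain ⟨v⟩ := ‹Nonempty V›
    refine ⟨(⊤ : G.Subgraph).induce (({v} : Finset V) : Set V), Finset.finite_toSet _,
      ⟨v, by simp⟩, ?_⟩
    exact SimpleGraph.lt_averageDegree_induce (E := ∅) (Finset.singleton_nonempty v)
      (by simp) (by simpa using hneg)
  · refine SimpleGraph.exists_averageDegree_of_cutsOff N hN
      (fun v => hcm.trans_lt (hNcard v)) (fun ω => (hdom ω).1) fun ω F hF => ?_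
    refine SimpleGraph.exists_cutsOff (hdom ω).1 hnonneg (fun η hη => ?_) hF
    exact SimpleGraph.lt_limitRatio_of_lt_relativeDegree (hdom ω).1 (hdom ω).2 (hδ.2 ω) η hη
      hnonneg
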